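/- Consider randomized learning algorithms on a random access machine with logarithmic cost. A labelled example of $f:\{-1,1\}^n\to\{-1,1\}$ is a pair $(x,f(x))$ with $x$ uniform in $\{-1,1\}^n$, independently for each request. An $s$-term monotone DNF expression is a disjunction of (at most) $s$ conjunctions of unnegated variables, where $1$ means true. There is an algorithm that PAC learns $s$-term monotone DNF expressions over the uniform distribution to accuracy $\epsilon$, from random labelled examples alone, in time $\tilde{O}\big(n\cdot (s\log(s/\epsilon))^{O(\log(s/\epsilon))}\big)$. That is, there are a single randomized program $L$, a single deterministic program $V$ and constants $a,A>0$, $b\in\mathbb{N}$ such that the following holds for all integers $n,s\ge 1$, all real $0<\epsilon\le 1$ and every $f:\{-1,1\}^n\to\{-1,1\}$ computed by an $s$-term monotone DNF expression. Put $$Y = n\cdot\big(s\log_2(s/\epsilon)\big)^{a\log_2(s/\epsilon)},\qquad T = A\cdot Y\cdot\big(\log_2(2+Y)\big)^b$$ (with $0^0=1$). Given $n$, $s$, $\lceil 1/\epsilon\rceil$ and labelled examples of $f$, the program $L$ always halts within time $T$ and outputs a representation of a hypothesis $h:\{-1,1\}^n\to\{-1,1\}$ from which $V$ computes $h(x)$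 within time $T$ for every $x\in\{-1,1\}^n$; and with probability at least $1/2$ over the examples and the coin tosses of $L$, $\Pr_x[h(x)=f(x)]\ge 1-\epsilon$ for uniform $x$. -/

import Mathlib

open MeasureTheory

namespace MonotoneDNF

/-! ## Points, functions and distributions -/

/-- The Boolean cube `{-1,1}^n`; the value `1` is written `true` and `-1` is written `false`. -/
abbrev Cube (n : ℕ) : Type := Fin n → Bool

/-- `f` is (computed by) a monotone DNF expression with at most `s` terms. A monotone term is the
conjunction of a set of unnegated variables, and the expression is the disjunction of its terms. -/
def IsMonotoneDNF {n : ℕ} (s : ℕ) (f : Cube n → Bool) : Prop :=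
  ∃ D : Finset (Finset (Fin n)), D.card ≤ s ∧
    ∀ x : Cube n, f x = true ↔ ∃ T ∈ D, ∀ i ∈ T, x i = true

/-- The uniform distribution on the cube. -/
noncomputable def uniform (n : ℕ) : Measure (Cube n) :=
  (PMF.uniformOfFintype (Cube n)).toMeasure

instance (n : ℕ) : IsProbabilityMeasure (uniform n) := by
  unfold uniform; infer_instance

/-- The distribution of one fair coin. -/
noncomputable def fairCoin : Measure Bool := (PMF.uniformOfFintype Bool).toMeasure

instance : IsProbabilityMeasure fairCoin := by
  unfold fairCoin; infer_instance

/-- `h` is `ε`-close to `f` relative to the uniform distribution. -/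
def IsClose {n : ℕ} (ε : ℝ) (f h : Cube n → Bool) : Prop :=
  1 - ε ≤ (uniform n).real {x | f x = h x}

/-! ## A random access machine with logarithmic cost

The machine has registers `reg 0, reg 1, …` and arrays `arr 0, arr 1, …`, all holding natural
numbers of arbitrary size. A program is a fixed finite text and mentions finitely many registers
and arrays by name; cells of an array are addressed by computed indices. Every operation is
charged by the bit lengths (`Nat.size`) of the numbers that it handles. -/

/-- The memory of the machine, together with the numbers of examples and of coins used so far
(these two are not accessible to the program). -/
structure State where
  reg : ℕ → ℕ
  arr : ℕ → ℕ → ℕ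
  drawn : ℕ
  flipped : ℕ

/-- Binary operations on numbers. -/
inductive BinOp where
  | add | sub | mul | div | mod | lt | eq

/-- Subtraction is truncated, `a / 0 = 0`, `a % 0 = a`, and comparisons return `0` or `1`. -/
def BinOp.eval : BinOp → ℕ → ℕ → ℕ
  | .add, a, b => a + b
  | .sub, a, b => a - b
  | .mul, a, b => a * b
  | .div, a, b => a / b
  | .mod, a, b => a % b
  | .lt, a, b => if a < b then 1 else 0
  | .eq, a, b => if a = b then 1 else 0

/-- Expressions: constants, registers, array cells `arr a [e]`, and binary operations. -/
inductive Expr where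
  | const (c : ℕ)
  | reg (r : ℕ)
  | cell (a : ℕ) (e : Expr)
  | op (o : BinOp) (e₁ e₂ : Expr)

/-- The value of an expression. -/
def Expr.eval (σ : State) : Expr → ℕ
  | .const c => c
  | .reg r => σ.reg r
  | .cell a e => σ.arr a (e.eval σ)
  | .op o e₁ e₂ => o.eval (e₁.eval σ) (e₂.eval σ)

/-- The time to evaluate an expression. A binary operation is charged the product of the bit
lengths of its operands (each increased by one), which is at least the time of the schoolbook
methods. -/
def Expr.cost (σ : State) : Expr → ℕ
  | .const c => 1 + c.size
  | .reg r => 1 + (σ.reg r).size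
  | .cell a e => e.cost σ + (1 + (e.eval σ).size + (σ.arr a (e.eval σ)).size)
  | .op _ e₁ e₂ =>
      e₁.cost σ + e₂.cost σ + (1 + (e₁.eval σ).size) * (1 + (e₂.eval σ).size)

/-- Programs. `sample` requests a labelled example, `flip r` tosses a coin into register `r`. -/
inductive Program where
  | skip
  | assign (r : ℕ) (e : Expr)
  | store (a : ℕ) (i e : Expr)
  | sample
  | flip (r : ℕ)
  | seq (p q : Program)
  | ite (e : Expr) (p q : Program)
  | loop (e : Expr) (p : Program)

/-- The program requests no examples and tosses no coins. -/
def Program.OracleFree : Program → Prop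
  | .skip => True
  | .assign _ _ => True
  | .store _ _ _ => True
  | .sample => False
  | .flip _ => False
  | .seq p q => p.OracleFree ∧ q.OracleFree
  | .ite _ p q => p.OracleFree ∧ q.OracleFree
  | .loop _ p => p.OracleFree

/-- Write `v` into register `r`. -/
def State.setReg (σ : State) (r v : ℕ) : State :=
  { σ with reg := Function.update σ.reg r v }

/-- Write `v` into cell `i` of array `a`. -/
def State.setCell (σ : State) (a i v : ℕ) : State :=
  { σ with arr := Function.update σ.arr a (Function.update (σ.arr a) i v) }

/-- Write the point `x` into cells `0, …, n - 1` of array `0` (`1` for `true`, `0` for `false`),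
and the bit `b` into cell `n` of that array. -/
def State.load {n : ℕ} (σ : State) (x : Cube n) (b : Bool) : State :=
  { σ with
    arr := Function.update σ.arr 0 fun i =>
      if h : i < n then (x ⟨i, h⟩).toNat else if i = n then b.toNat else σ.arr 0 i }

/-- What the outside world supplies to a run: the target function, the points of the
successive examples, and the outcomes of the successive coin tosses. -/
structure Oracles (n : ℕ) where
  target : Cube n → Bool
  point : ℕ → Cube n
  coin : ℕ → Bool

/-- `Exec O p σ t τ`: with oracles `O`, program `p` started in `σ` halts in `τ` after time `t`.
The body of `loop e p` is repeated as long as `e` is nonzero. Requesting an example takes the time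
of writing its `n + 1` bits into cells `0, …, n` of array `0`. -/
inductive Exec {n : ℕ} (O : Oracles n) : Program → State → ℕ → State → Prop
  | skip (σ : State) : Exec O .skip σ 1 σ
  | assign (r : ℕ) (e : Expr) (σ : State) :
      Exec O (.assign r e) σ (1 + e.cost σ) (σ.setReg r (e.eval σ))
  | store (a : ℕ) (i e : Expr) (σ : State) :
      Exec O (.store a i e) σ (1 + i.cost σ + e.cost σ) (σ.setCell a (i.eval σ) (e.eval σ))
  | sample (σ : State) :
      Exec O .sample σ ((n + 1) * (1 + n.size))
        { σ.load (O.point σ.drawn) (O.target (O.point σ.drawn)) with drawn := σ.drawn + 1 }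
  | flip (r : ℕ) (σ : State) :
      Exec O (.flip r) σ 1
        { σ.setReg r (O.coin σ.flipped).toNat with flipped := σ.flipped + 1 }
  | seq {p q : Program} {σ τ υ : State} {t u : ℕ} :
      Exec O p σ t τ → Exec O q τ u υ → Exec O (.seq p q) σ (t + u) υ
  | iteTrue {e : Expr} {p q : Program} {σ τ : State} {t : ℕ} :
      e.eval σ ≠ 0 → Exec O p σ t τ → Exec O (.ite e p q) σ (1 + e.cost σ + t) τ
  | iteFalse {e : Expr} {p q : Program} {σ τ : State} {t : ℕ} :
      e.eval σ = 0 → Exec O q σ t τ → Exec O (.ite e p q) σ (1 + e.cost σ + t) τ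
  | loopDone {e : Expr} {p : Program} {σ : State} :
      e.eval σ = 0 → Exec O (.loop e p) σ (1 + e.cost σ) σ
  | loopStep {e : Expr} {p : Program} {σ τ υ : State} {t u : ℕ} :
      e.eval σ ≠ 0 → Exec O p σ t τ → Exec O (.loop e p) τ u υ →
        Exec O (.loop e p) σ (1 + e.cost σ + t + u) υ

/-! ## PAC learning over the uniform distribution -/

/-- The initial memory of a learner: the dimension `n`, the size parameter `s` and the accuracy
parameter `k` (standing for accuracy `1 / k`) are in registers `0`, `1`, `2`; the rest is zero. -/
def inputState (n s k : ℕ) : State where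
  reg := fun r => if r = 0 then n else if r = 1 then s else if r = 2 then k else 0
  arr := fun _ _ => 0
  drawn := 0
  flipped := 0

/-- The oracles of a program that has no access to examples or coins. -/
def noOracles (n : ℕ) : Oracles n where
  target := fun _ => false
  point := fun _ _ => false
  coin := fun _ => false

/-- The random source of a learner: the points of the examples, and the coins. -/
abbrev Source (n : ℕ) : Type := (ℕ → Cube n) × (ℕ → Bool)

/-- The law of the random source: the points are independent and uniform, the coins are
independent and fair, and points and coins are independent. -/
noncomputable def sourceLaw (n : ℕ) : Measure (Source n) :=
  (Measure.infinitePi fun _ : ℕ => uniform n).prod (Measure.infinitePi fun _ : ℕ => fairCoin)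

/-- On input `n, s, k`, with examples labelled by `f` and with random source `ω`, the learner `L`
halts within time `T`, and the memory that it leaves represents the hypothesis `h` under the
evaluation program `V`: started from this memory and an arbitrary point `x`, the program `V`
halts within time `T`, and register `0` is then nonzero exactly if `h x` is true. -/
def Outputs (L V : Program) {n : ℕ} (s k : ℕ) (f : Cube n → Bool) (ω : Source n) (T : ℝ)
    (h : Cube n → Bool) : Prop :=
  ∃ (σ : State) (t : ℕ), Exec ⟨f, ω.1, ω.2⟩ L (inputState n s k) t σ ∧ (t : ℝ) ≤ T ∧
    ∀ x : Cube n, ∃ (τ : State) (u : ℕ), Exec (noOracles n) V (σ.load x false) u τ ∧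
      (u : ℝ) ≤ T ∧ (h x = true ↔ τ.reg 0 ≠ 0)

/-- The learner `L`, with hypotheses evaluated by the deterministic program `V`, PAC learns the
classes `C n s` over the uniform distribution in time `T n s ε` from random examples alone: for
all `n`, `s`, every accuracy `ε` (which the learner is told through the integer `⌈1 / ε⌉`) and
every target in `C n s`, it always halts with a hypothesis within the time bound, and with
probability at least `1 / 2` the hypothesis is `ε`-close to the target. -/
def PACLearns (L V : Program) (C : (n s : ℕ) → Set (Cube n → Bool)) (T : ℕ → ℕ → ℝ → ℝ) :
    Prop :=
  V.OracleFree ∧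
  ∀ (n s : ℕ) (ε : ℝ), 1 ≤ n → 1 ≤ s → 0 < ε → ε ≤ 1 → ∀ f ∈ C n s,
    (∀ ω : Source n, ∃ h, Outputs L V s ⌈1 / ε⌉₊ f ω (T n s ε) h) ∧
    1 / 2 ≤ sourceLaw n {ω | ∃ h, Outputs L V s ⌈1 / ε⌉₊ f ω (T n s ε) h ∧ IsClose ε f h}

/-- `n · (s · log (s / ε)) ^ (a · log (s / ε))`, with logarithms to base `2`. -/
noncomputable def mainTerm (a : ℝ) (n s : ℕ) (ε : ℝ) : ℝ :=
  n * (s * Real.logb 2 (s / ε)) ^ (a * Real.logb 2 (s / ε))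

end MonotoneDNF

namespace MonotoneDNF

/-! ## Bounded memory and the cost of expressions -/

instance : Add Expr := ⟨.op .add⟩
instance : Sub Expr := ⟨.op .sub⟩
instance : Mul Expr := ⟨.op .mul⟩
instance : Div Expr := ⟨.op .div⟩
instance : Mod Expr := ⟨.op .mod⟩

/-- The expression with value `1` if `e₁ < e₂` and `0` otherwise. -/
abbrev Expr.lt (e₁ e₂ : Expr) : Expr := .op .lt e₁ e₂

/-- The expression with value `1` if `e₁ = e₂` and `0` otherwise. -/
abbrev Expr.eq (e₁ e₂ : Expr) : Expr := .op .eq e₁ e₂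

section Eval
variable (σ : State) (e₁ e₂ : Expr)

@[simp] theorem Expr.eval_const (c : ℕ) : (Expr.const c).eval σ = c := rfl
@[simp] theorem Expr.eval_reg (r : ℕ) : (Expr.reg r).eval σ = σ.reg r := rfl
@[simp] theorem Expr.eval_cell (a : ℕ) : (Expr.cell a e₁).eval σ = σ.arr a (e₁.eval σ) := rfl
@[simp] theorem Expr.eval_add : (e₁ + e₂).eval σ = e₁.eval σ + e₂.eval σ := rfl
@[simp] theorem Expr.eval_sub : (e₁ - e₂).eval σ = e₁.eval σ - e₂.eval σ := rfl
@[simp] theorem Expr.eval_mul : (e₁ * e₂).eval σ = e₁.eval σ * e₂.eval σ := rfl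
@[simp] theorem Expr.eval_div : (e₁ / e₂).eval σ = e₁.eval σ / e₂.eval σ := rfl
@[simp] theorem Expr.eval_mod : (e₁ % e₂).eval σ = e₁.eval σ % e₂.eval σ := rfl
@[simp] theorem Expr.eval_lt :
    (Expr.op .lt e₁ e₂).eval σ = if e₁.eval σ < e₂.eval σ then 1 else 0 := rfl
@[simp] theorem Expr.eval_eq :
    (Expr.op .eq e₁ e₂).eval σ = if e₁.eval σ = e₂.eval σ then 1 else 0 := rfl

end Eval

/-- All numbers in the memory have at most `l` bits. -/
structure State.Bounded (l : ℕ) (σ : State) : Prop where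
  reg : ∀ r, (σ.reg r).size ≤ l
  arr : ∀ a i, (σ.arr a i).size ≤ l

section Memory
variable (σ : State)

@[simp] theorem State.setReg_reg (r v r' : ℕ) :
    (σ.setReg r v).reg r' = if r' = r then v else σ.reg r' := by
  simp [State.setReg, Function.update_apply]

@[simp] theorem State.setReg_arr (r v : ℕ) : (σ.setReg r v).arr = σ.arr := rfl

@[simp] theorem State.setReg_drawn (r v : ℕ) : (σ.setReg r v).drawn = σ.drawn := rfl

@[simp] theorem State.setCell_reg (a i v : ℕ) : (σ.setCell a i v).reg = σ.reg := rfl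

@[simp] theorem State.setCell_drawn (a i v : ℕ) : (σ.setCell a i v).drawn = σ.drawn := rfl

@[simp] theorem State.setCell_arr (a i v a' i' : ℕ) :
    (σ.setCell a i v).arr a' i' = if a' = a ∧ i' = i then v else σ.arr a' i' := by
  by_cases h : a' = a
  · subst h; simp [State.setCell, Function.update_apply]
  · simp [State.setCell, h]

end Memory

theorem State.Bounded.setReg {l : ℕ} {σ : State} (h : σ.Bounded l) {r v : ℕ} (hv : v.size ≤ l) :
    (σ.setReg r v).Bounded l := by
  refine ⟨fun r' => ?_, h.arr⟩
  rw [State.setReg_reg]; split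
  · exact hv
  · exact h.reg r'

theorem State.Bounded.setCell {l : ℕ} {σ : State} (h : σ.Bounded l) {a i v : ℕ}
    (hv : v.size ≤ l) : (σ.setCell a i v).Bounded l := by
  refine ⟨h.reg, fun a' i' => ?_⟩
  rw [State.setCell_arr]; split
  · exact hv
  · exact h.arr a' i'

theorem State.Bounded.load {l n : ℕ} {σ : State} (h : σ.Bounded l) (hl : 1 ≤ l) (x : Cube n)
    (b : Bool) : (σ.load x b).Bounded l := by
  have hb : ∀ c : Bool, c.toNat.size ≤ l := by
    rintro (_ | _) <;> simp [hl]
  refine ⟨h.reg, fun a' i' => ?_⟩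
  by_cases ha : a' = 0
  · subst ha
    simp only [State.load, Function.update_self]
    split_ifs
    · exact hb _
    · exact hb _
    · exact h.arr 0 i'
  · simpa [State.load, ha] using h.arr a' i'

theorem size_add_le (a b : ℕ) : (a + b).size ≤ a.size + b.size := by
  rcases Nat.eq_zero_or_pos a with rfl | ha
  · simp
  rcases Nat.eq_zero_or_pos b with rfl | hb
  · simp
  rw [Nat.size_le]
  have h1 := Nat.lt_size_self a
  have h2 := Nat.lt_size_self b
  have h3 : 2 ≤ 2 ^ a.size := Nat.pow_le_pow_right (n := 2) (by norm_num) (Nat.size_pos.2 ha)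
  have h4 : 2 ≤ 2 ^ b.size := Nat.pow_le_pow_right (n := 2) (by norm_num) (Nat.size_pos.2 hb)
  rw [pow_add]
  nlinarith

theorem size_mul_le (a b : ℕ) : (a * b).size ≤ a.size + b.size := by
  rw [Nat.size_le, pow_add]
  exact Nat.mul_lt_mul'' (Nat.lt_size_self a) (Nat.lt_size_self b)

theorem BinOp.size_eval_le (o : BinOp) (a b : ℕ) : (o.eval a b).size ≤ 1 + (a.size + b.size) := by
  have key : ∀ c : ℕ, c ≤ a → c.size ≤ 1 + (a.size + b.size) := fun c hc =>
    (Nat.size_le_size hc).trans (by omega)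
  have bit : ∀ c : ℕ, c ≤ 1 → c.size ≤ 1 + (a.size + b.size) := fun c hc =>
    (Nat.size_le_size hc).trans (by simp)
  cases o
  · exact (size_add_le a b).trans (by omega)
  · exact key _ (Nat.sub_le _ _)
  · exact (size_mul_le a b).trans (by omega)
  · exact key _ (Nat.div_le_self _ _)
  · exact key _ (Nat.mod_le _ _)
  · apply bit; simp only [BinOp.eval]; split <;> simp
  · apply bit; simp only [BinOp.eval]; split <;> simp

/-- A bound for the size of the value of an expression, in multiples of the word length. -/
def Expr.scale : Expr → ℕ
  | .const c => c
  | .reg _ => 1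
  | .cell _ _ => 1
  | .op _ e₁ e₂ => 1 + (e₁.scale + e₂.scale)

/-- A bound for the cost of an expression, in multiples of the square of the word length. -/
def Expr.weight : Expr → ℕ
  | .const c => 1 + c
  | .reg _ => 2
  | .cell _ e => e.weight + (2 + e.scale)
  | .op _ e₁ e₂ => e₁.weight + e₂.weight + (1 + e₁.scale) * (1 + e₂.scale)

theorem Expr.size_eval_le {l : ℕ} {σ : State} (h : σ.Bounded l) (hl : 1 ≤ l) (e : Expr) :
    (e.eval σ).size ≤ e.scale * l := by
  induction e with
  | const c =>
    have : c.size ≤ c := Nat.size_le.2 Nat.lt_two_pow_self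
    exact this.trans (Nat.le_mul_of_pos_right _ hl)
  | reg r => simpa [Expr.scale] using h.reg r
  | cell a e _ => simpa [Expr.scale] using h.arr a _
  | op o e₁ e₂ h₁ h₂ =>
    refine (o.size_eval_le _ _).trans ?_
    simp only [Expr.scale]
    nlinarith

theorem Expr.cost_le {l : ℕ} {σ : State} (h : σ.Bounded l) (hl : 1 ≤ l) (e : Expr) :
    e.cost σ ≤ e.weight * l ^ 2 := by
  have hl2 : l ≤ l ^ 2 := Nat.le_self_pow (by norm_num) l
  induction e with
  | const c =>
    have h1 : c.size ≤ c := Nat.size_le.2 Nat.lt_two_pow_self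
    simp only [Expr.cost, Expr.weight]
    nlinarith
  | reg r =>
    have := h.reg r
    simp only [Expr.cost, Expr.weight]
    nlinarith
  | cell a e ih =>
    have h1 := h.arr a (e.eval σ)
    have h2 := e.size_eval_le h hl
    simp only [Expr.cost, Expr.weight]
    nlinarith [Nat.mul_le_mul_left e.scale hl2]
  | op o e₁ e₂ ih₁ ih₂ =>
    have h1 := e₁.size_eval_le h hl
    have h2 := e₂.size_eval_le h hl
    have h3 : 1 + (e₁.eval σ).size ≤ (1 + e₁.scale) * l := by nlinarith
    have h4 : 1 + (e₂.eval σ).size ≤ (1 + e₂.scale) * l := by nlinarith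
    have := Nat.mul_le_mul h3 h4
    simp only [Expr.cost, Expr.weight]
    nlinarith

/-! ## Total correctness with time bounds -/

/-- Started in `σ`, the program halts after time at most `c * l ^ 2` in a state that satisfies
`Q`. -/
def Halts {n : ℕ} (O : Oracles n) (l : ℕ) (p : Program) (σ : State) (c : ℕ) (Q : State → Prop) :
    Prop :=
  ∃ (t : ℕ) (τ : State), Exec O p σ t τ ∧ t ≤ c * l ^ 2 ∧ Q τ

section Rules
variable {n l : ℕ} {O : Oracles n} {p q : Program} {σ : State} {c d : ℕ} {Q Q' : State → Prop}

theorem Halts.mono (h : Halts O l p σ c Q) (hc : c ≤ d) (hQ : ∀ τ, Q τ → Q' τ) :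
    Halts O l p σ d Q' := by
  obtain ⟨t, τ, h1, h2, h3⟩ := h
  exact ⟨t, τ, h1, h2.trans (Nat.mul_le_mul_right _ hc), hQ _ h3⟩

theorem Halts.seq (d : ℕ) (hd : d ≤ c)
    (h : Halts O l p σ d fun τ => Halts O l q τ (c - d) Q) : Halts O l (.seq p q) σ c Q := by
  obtain ⟨t, τ, h1, h2, u, υ, h3, h4, h5⟩ := h
  refine ⟨t + u, υ, .seq h1 h3, ?_, h5⟩
  calc t + u ≤ (d + (c - d)) * l ^ 2 := by rw [add_mul]; omega
    _ = c * l ^ 2 := by rw [Nat.add_sub_cancel' hd]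

theorem Halts.assign {r : ℕ} {e : Expr} (h : σ.Bounded l) (hl : 1 ≤ l) (hc : 1 + e.weight ≤ c)
    (hQ : Q (σ.setReg r (e.eval σ))) : Halts O l (.assign r e) σ c Q := by
  refine Halts.mono ⟨_, _, .assign r e σ, ?_, hQ⟩ hc fun _ h => h
  have := e.cost_le h hl
  have hl2 : 1 ≤ l ^ 2 := Nat.one_le_pow _ _ hl
  nlinarith

theorem Halts.assign_seq {r : ℕ} {e : Expr} (h : σ.Bounded l) (hl : 1 ≤ l)
    (hc : 1 + e.weight ≤ c)
    (hq : Halts O l q (σ.setReg r (e.eval σ)) (c - (1 + e.weight)) Q) :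
    Halts O l (.seq (.assign r e) q) σ c Q :=
  .seq _ hc (.assign h hl le_rfl hq)

theorem Halts.store {a : ℕ} {i e : Expr} (h : σ.Bounded l) (hl : 1 ≤ l)
    (hc : 1 + i.weight + e.weight ≤ c)
    (hQ : Q (σ.setCell a (i.eval σ) (e.eval σ))) :
    Halts O l (.store a i e) σ c Q := by
  refine Halts.mono ⟨_, _, .store a i e σ, ?_, hQ⟩ hc fun _ h => h
  have h1 := e.cost_le h hl
  have h2 := i.cost_le h hl
  have hl2 : 1 ≤ l ^ 2 := Nat.one_le_pow _ _ hl
  nlinarith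

theorem Halts.store_seq {a : ℕ} {i e : Expr} (h : σ.Bounded l) (hl : 1 ≤ l)
    (hc : 1 + i.weight + e.weight ≤ c)
    (hq : Halts O l q (σ.setCell a (i.eval σ) (e.eval σ)) (c - (1 + i.weight + e.weight)) Q) :
    Halts O l (.seq (.store a i e) q) σ c Q :=
  .seq _ hc (.store h hl le_rfl hq)

theorem Halts.sample (hn : n.size ≤ l) (hl : 1 ≤ l)
    (hQ : Q { σ.load (O.point σ.drawn) (O.target (O.point σ.drawn)) with
      drawn := σ.drawn + 1 }) :
    Halts O l .sample σ ((n + 1) * 2) Q := by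
  refine ⟨_, _, .sample σ, ?_, hQ⟩
  have hl2 : l ≤ l ^ 2 := Nat.le_self_pow (by norm_num) l
  rw [mul_assoc]
  exact Nat.mul_le_mul_left _ (by omega)

/-- Run `p` with register `i` counting from `0` up to the content of register `b`. -/
def Program.count (i b : ℕ) (p : Program) : Program :=
  .seq (.assign i (.const 0))
    (.loop (.lt (.reg i) (.reg b)) (.seq p (.assign i (.reg i + .const 1))))

theorem Halts.count {i b N : ℕ} (d : ℕ) (I : ℕ → State → Prop) (hl : 1 ≤ l)
    (hd : (N + 1) * (d + 18) ≤ c)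
    (hI : ∀ j τ, I j τ → τ.Bounded l ∧ τ.reg i = j ∧ τ.reg b = N)
    (h0 : I 0 (σ.setReg i 0))
    (hp : ∀ j, j < N → ∀ τ, I j τ → Halts O l p τ d fun υ =>
      υ.Bounded l ∧ υ.reg i = j ∧ I (j + 1) (υ.setReg i (j + 1))) :
    Halts O l (.count i b p) σ c (I N) := by
  refine Halts.mono (c := (N + 1) * (d + 18)) ?_ hd fun _ h => h
  have hl2 : 1 ≤ l ^ 2 := Nat.one_le_pow _ _ hl
  have key : ∀ a j, j + a = N → ∀ τ, I j τ →
      ∃ (t : ℕ) (υ : State), Exec O (.loop (.lt (.reg i) (.reg b))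
        (.seq p (.assign i (.reg i + .const 1)))) τ t υ ∧
        t ≤ (a * (d + 18) + 9) * l ^ 2 ∧ I N υ := by
    intro a
    induction a with
    | zero =>
      intro j hj τ hτ
      obtain ⟨h1, h2, h3⟩ := hI j τ hτ
      refine ⟨_, τ, .loopDone ?_, ?_, ?_⟩
      · simp [h2, h3]; omega
      · have := (Expr.lt (.reg i) (.reg b)).cost_le h1 hl
        simp only [Expr.weight, Expr.scale] at this
        nlinarith
      · obtain rfl : j = N := by omega
        exact hτ
    | succ a ih =>
      intro j hj τ hτ
      obtain ⟨h1, h2, h3⟩ := hI j τ hτ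
      obtain ⟨t, υ, h4, h5, h6, h7, h8⟩ := hp j (by omega) τ hτ
      obtain ⟨t', υ', h9, h10, h11⟩ := ih (j + 1) (by omega) _ h8
      have hinc := Exec.assign (O := O) i (.reg i + .const 1) υ
      have he : (Expr.reg i + .const 1).eval υ = j + 1 := by simp [h7]
      have hc2 : (Expr.reg i + .const 1).cost υ ≤ _ :=
        (Expr.reg i + .const 1).cost_le h6 hl
      rw [he] at hinc
      refine ⟨_, υ', .loopStep ?_ (.seq h4 hinc) h9, ?_, h11⟩
      · simp [h2, h3]; omega
      · have hc1 := (Expr.lt (.reg i) (.reg b)).cost_le h1 hl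
        have hw : (Expr.reg i + .const 1).weight = 8 := rfl
        rw [hw] at hc2
        simp only [Expr.weight, Expr.scale] at hc1
        nlinarith
  obtain ⟨t, υ, h1, h2, h3⟩ := key N 0 (by omega) _ h0
  refine ⟨_, υ, .seq (.assign i _ σ) h1, ?_, h3⟩
  simp only [Expr.cost, Nat.size_zero]
  nlinarith

end Rules

/-! ## The parts of the learner -/

/-- The numbers that the learner computes from its input. -/
structure Params where
  width : ℕ
  base : ℕ
  terms : ℕ
  samples : ℕ
  agreeThreshold : ℕ
  badThreshold : ℕ

/-- The parameters are in their registers, and the cell after the label holds `1`. -/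
structure Ready (P : Params) (n l : ℕ) (σ : State) : Prop where
  bounded : σ.Bounded l
  dim : σ.reg 0 = n
  width : σ.reg 3 = P.width
  base : σ.reg 4 = P.base
  terms : σ.reg 5 = P.terms
  samples : σ.reg 6 = P.samples
  agreeThreshold : σ.reg 7 = P.agreeThreshold
  badThreshold : σ.reg 8 = P.badThreshold
  one : σ.arr 0 (n + 1) = 1

theorem Ready.setReg {P : Params} {n l : ℕ} {σ : State} (h : Ready P n l σ) {r v : ℕ}
    (hr : 9 ≤ r) (hv : v.size ≤ l) : Ready P n l (σ.setReg r v) := by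
  obtain ⟨h0, h1, h2, h3, h4, h5, h6, h7, h8⟩ := h
  refine ⟨h0.setReg hv, ?_, ?_, ?_, ?_, ?_, ?_, ?_, h8⟩ <;>
    rw [State.setReg_reg, if_neg (by omega)] <;> assumption

theorem Ready.setCell {P : Params} {n l : ℕ} {σ : State} (h : Ready P n l σ) {a i v : ℕ}
    (ha : a ≠ 0) (hv : v.size ≤ l) : Ready P n l (σ.setCell a i v) := by
  obtain ⟨h0, h1, h2, h3, h4, h5, h6, h7, h8⟩ := h
  refine ⟨h0.setCell hv, h1, h2, h3, h4, h5, h6, h7, ?_⟩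
  rw [State.setCell_arr, if_neg (by tauto), h8]

/-- The coordinate of a point at an arbitrary index; `true` outside the range. -/
def lookup {n : ℕ} (x : Cube n) (i : ℕ) : Bool := if h : i < n then x ⟨i, h⟩ else true

theorem lookup_val {n : ℕ} (x : Cube n) (i : Fin n) : lookup x i = x i := by simp [lookup]

section Load
variable {n : ℕ} (σ : State) (x : Cube n) (b : Bool)

@[simp] theorem State.load_reg : (σ.load x b).reg = σ.reg := rfl

theorem State.load_arr_of_ne {a : ℕ} (ha : a ≠ 0) : (σ.load x b).arr a = σ.arr a := by
  simp [State.load, ha]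

theorem State.load_arr_lt {i : ℕ} (hi : i < n) :
    (σ.load x b).arr 0 i = (lookup x i).toNat := by
  simp [State.load, lookup, hi]

theorem State.load_arr_dim : (σ.load x b).arr 0 n = b.toNat := by
  simp [State.load]

theorem State.load_arr_gt {i : ℕ} (hi : n < i) : (σ.load x b).arr 0 i = σ.arr 0 i := by
  simp [State.load, hi.not_gt, hi.ne']

end Load

theorem Ready.load {P : Params} {n l : ℕ} {σ : State} (h : Ready P n l σ) (hl : 1 ≤ l)
    (x : Cube n) (b : Bool) : Ready P n l (σ.load x b) := by
  obtain ⟨h0, h1, h2, h3, h4, h5, h6, h7, h8⟩ := h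
  refine ⟨h0.load hl x b, h1, h2, h3, h4, h5, h6, h7, ?_⟩
  rw [State.load_arr_gt _ _ _ (Nat.lt_succ_self n), h8]

theorem Ready.draw {P : Params} {n l : ℕ} {σ : State} (h : Ready P n l σ) (d : ℕ) :
    Ready P n l { σ with drawn := d } := by
  obtain ⟨⟨h0, h0'⟩, h1, h2, h3, h4, h5, h6, h7, h8⟩ := h
  exact ⟨⟨h0, h0'⟩, h1, h2, h3, h4, h5, h6, h7, h8⟩

section Phases

variable {n l : ℕ} {O : Oracles n} {P : Params} {σ : State}

/-- Evaluate the conjunction whose number is in register `10`: its variables are the entries of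
array `2` at the digits of the number. The result is left in register `13`. -/
def runConjunction : Program :=
  .seq (.assign 12 (.reg 10)) <| .seq (.assign 13 (.const 1)) <|
    .count 11 3 <|
      .seq (.assign 13 (.reg 13 * .cell 0 (.cell 2 (.reg 12 % .reg 4))))
        (.assign 12 (.reg 12 / .reg 4))

theorem runConjunction_halts (hl : 1 ≤ l) (h : Ready P n l σ) (b : ℕ → Bool)
    (hb : ∀ d < P.width, σ.arr 0 (σ.arr 2 (σ.reg 10 / P.base ^ d % P.base)) = (b d).toNat) :
    Halts O l runConjunction σ ((P.width + 1) * 200) fun τ =>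
      Ready P n l τ ∧ (∀ r, r < 11 ∨ 13 < r → τ.reg r = σ.reg r) ∧ τ.arr = σ.arr ∧
      τ.drawn = σ.drawn ∧ τ.reg 13 = if ∀ d < P.width, b d = true then 1 else 0 := by
  have hone : Nat.size 1 ≤ l := by simpa using hl
  have h1 := h.setReg (r := 12) (v := σ.reg 10) (by norm_num) (h.bounded.reg 10)
  have h2 := h1.setReg (r := 13) (v := 1) (by norm_num) hone
  refine .assign_seq h.bounded hl (by simp only [Expr.weight]; omega) <|
    .assign_seq h1.bounded hl (by simp only [Expr.weight]; omega) <| .mono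
    (.count (c := (P.width + 1) * 200 - 10) 60 (I := fun j τ => Ready P n l τ ∧ τ.reg 11 = j ∧
      (∀ r, r < 11 ∨ 13 < r → τ.reg r = σ.reg r) ∧ τ.arr = σ.arr ∧ τ.drawn = σ.drawn ∧
      τ.reg 12 = σ.reg 10 / P.base ^ j ∧
      τ.reg 13 = if ∀ d < j, b d = true then 1 else 0) (N := P.width) hl (by omega) ?_ ?_
      fun j hj τ hτ => ?_) (by simp only [Expr.weight]; omega) ?_
  · rintro j τ ⟨h1, h2, -⟩
    exact ⟨h1.bounded, h2, h1.width⟩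
  · refine ⟨h2.setReg (by norm_num) (by simp), ?_⟩
    refine ⟨by simp, fun r hr => ?_, rfl, rfl, by simp, by simp⟩
    simp only [State.setReg_reg]
    rw [if_neg (by omega), if_neg (by omega), if_neg (by omega)]
  · obtain ⟨g1, g2, g3, g4, g5, g6, g7⟩ := hτ
    have hv : (Expr.reg 13 * .cell 0 (.cell 2 (.reg 12 % .reg 4))).eval τ =
        if ∀ d < j + 1, b d = true then 1 else 0 := by
      simp only [Expr.eval_mul, Expr.eval_reg, Expr.eval_cell, Expr.eval_mod, g7, g6, g4,
        g1.base, hb j hj, Nat.forall_lt_succ_right]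
      cases b j <;> simp
    have hq : τ.reg 12 / τ.reg 4 = σ.reg 10 / P.base ^ (j + 1) := by
      rw [g6, g1.base, Nat.div_div_eq_div_mul, pow_succ]
    have g8 := g1.setReg (r := 13) (v := if ∀ d < j + 1, b d = true then 1 else 0)
      (by norm_num) (by split <;> simp [hl])
    have hqs : (τ.reg 12 / τ.reg 4).size ≤ l :=
      (Nat.size_le_size (Nat.div_le_self _ _)).trans (g1.bounded.reg 12)
    have g9 := g8.setReg (r := 12) (v := τ.reg 12 / τ.reg 4) (by norm_num) hqs
    have hjl : (j + 1).size ≤ l := by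
      have := g1.bounded.reg 3
      rw [g1.width] at this
      exact (Nat.size_le_size hj).trans this
    refine .assign_seq g1.bounded hl (by decide) ?_
    rw [hv]
    refine .assign g8.bounded hl (by decide) ?_
    simp only [Expr.eval_div, Expr.eval_reg, State.setReg_reg, Nat.reduceEqDiff, reduceIte]
    refine ⟨g9.bounded, g2, g9.setReg (by norm_num) hjl, trivial, fun r hr => ?_, g4, g5, hq, trivial⟩
    rw [if_neg (by omega), if_neg (by omega), if_neg (by omega), g3 r hr]
  · rintro τ ⟨h1, -, h2, h3, h4, -, h5⟩
    exact ⟨h1, h2, h3, h4, h5⟩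

/-- The number of those among the first `m` examples in which variable `i` agrees with the
label. -/
def agreeCount (O : Oracles n) (m i : ℕ) : ℕ :=
  Nat.count (fun j => lookup (O.point j) i = O.target (O.point j)) m

/-- Count, for every variable, its agreements with the label, in array `1`. -/
def tallyAgreement : Program :=
  .count 9 6 <| .seq .sample <| .count 10 0 <|
    .store 1 (.reg 10) (.cell 1 (.reg 10) + .eq (.cell 0 (.reg 10)) (.cell 0 (.reg 0)))

theorem tallyAgreement_halts (hl : 1 ≤ l) (h : Ready P n l σ) (hd : σ.drawn = 0)
    (ha : ∀ i, σ.arr 1 i = 0) :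
    Halts O l tallyAgreement σ ((P.samples + 1) * ((n + 1) * 80)) fun τ =>
      Ready P n l τ ∧ τ.drawn = P.samples ∧ τ.arr 2 = σ.arr 2 ∧ τ.arr 3 = σ.arr 3 ∧
      ∀ i < n, τ.arr 1 i = agreeCount O P.samples i := by
  have hn : n.size ≤ l := h.dim ▸ h.bounded.reg 0
  have hm : P.samples.size ≤ l := h.samples ▸ h.bounded.reg 6
  refine .mono (.count (c := (P.samples + 1) * ((n + 1) * 80)) ((n + 1) * 62)
    (I := fun m τ => Ready P n l τ ∧ τ.reg 9 = m ∧ τ.drawn = m ∧ τ.arr 2 = σ.arr 2 ∧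
      τ.arr 3 = σ.arr 3 ∧ ∀ i < n, τ.arr 1 i = agreeCount O m i) (N := P.samples) hl
    (Nat.mul_le_mul_left _ (by omega)) ?_ ?_ fun m hm' τ hτ => ?_) le_rfl ?_
  · rintro j τ ⟨h1, h2, -⟩
    exact ⟨h1.bounded, h2, h1.samples⟩
  · exact ⟨h.setReg (by norm_num) (by simp), by simp, hd, rfl, rfl, by simp [ha, agreeCount]⟩
  · obtain ⟨g1, g2, g3, g4, g5, g6⟩ := hτ
    refine .seq ((n + 1) * 2) (by omega) (.sample hn hl ?_)
    rw [g3]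
    set x := O.point m with hx
    set b := O.target x with hb
    have g7 := (g1.load hl x b).draw (m + 1)
    set υ : State := { τ.load x b with drawn := m + 1 } with hυ
    have e0 : υ.arr 0 = (τ.load x b).arr 0 := rfl
    have e1 : υ.arr 1 = τ.arr 1 := State.load_arr_of_ne (a := 1) τ x b (by norm_num)
    have e2 : υ.arr 2 = τ.arr 2 := State.load_arr_of_ne (a := 2) τ x b (by norm_num)
    have e3 : υ.arr 3 = τ.arr 3 := State.load_arr_of_ne (a := 3) τ x b (by norm_num)
    refine .mono (.count (c := (n + 1) * 60) 42
      (I := fun i τ' => Ready P n l τ' ∧ τ'.reg 10 = i ∧ τ'.reg 9 = m ∧ τ'.drawn = m + 1 ∧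
        τ'.arr 0 = υ.arr 0 ∧ τ'.arr 2 = σ.arr 2 ∧ τ'.arr 3 = σ.arr 3 ∧
        (∀ i' < i, τ'.arr 1 i' = agreeCount O (m + 1) i') ∧
        ∀ i' < n, i ≤ i' → τ'.arr 1 i' = agreeCount O m i') (N := n) hl
      (Nat.mul_le_mul_left _ (by omega)) ?_ ?_ fun i hi τ' hτ' => ?_) (by omega) ?_
    · rintro j τ ⟨h1, h2, -⟩
      exact ⟨h1.bounded, h2, h1.dim⟩
    · exact ⟨g7.setReg (by norm_num) (by simp), by simp, by simpa [hυ] using g2, rfl, rfl,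
        e2.trans g4, e3.trans g5, by simp, fun i hi _ => (congrFun e1 i).trans (g6 i hi)⟩
    · obtain ⟨k1, k2, k3, k4, k5, k6, k7, k8, k9⟩ := hτ'
      have hv : (Expr.cell 1 (.reg 10) + .eq (.cell 0 (.reg 10)) (.cell 0 (.reg 0))).eval τ' =
          agreeCount O (m + 1) i := by
        simp only [Expr.eval_add, Expr.eval_cell, Expr.eval_reg, Expr.eval_eq, k2, k5, k1.dim, e0,
          State.load_arr_lt _ _ _ hi, State.load_arr_dim, k9 i hi le_rfl, agreeCount,
          Nat.count_succ, ← hx, ← hb]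
        congr 1
        cases lookup x i <;> cases b <;> simp
      have hs : (agreeCount O (m + 1) i).size ≤ l :=
        (Nat.size_le_size ((Nat.count_le _).trans hm')).trans hm
      have k10 := k1.setCell (a := 1) (i := i) (by norm_num) hs
      refine .store k1.bounded hl (by decide) ?_
      rw [hv, Expr.eval_reg, k2]
      refine ⟨k10.bounded, k2, k10.setReg (by norm_num) ((Nat.size_le_size hi).trans hn),
        by simp, by simpa using k3, k4, ?_, ?_, ?_, fun i' hi' => ?_, fun i' hi' hi2 => ?_⟩
      · funext a; simp [k5]
      · funext a; simp [k6]
      · funext a; simp [k7]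
      · rcases Nat.lt_succ_iff_lt_or_eq.1 hi' with h' | rfl
        · simp [h'.ne, k8 i' h']
        · simp
      · simp only [State.setReg_arr, State.setCell_arr]
        rw [if_neg (by omega), k9 i' hi' (by omega)]
    · rintro τ' ⟨k1, k2, k3, k4, k5, k6, k7, k8, k9⟩
      exact ⟨k1.bounded, k3, k1.setReg (by norm_num) ((Nat.size_le_size hm').trans hm), by simp,
        k4, k6, k7, k8⟩
  · rintro τ ⟨h1, -, h2⟩
    exact ⟨h1, h2⟩

/-- Write the variables whose count exceeds the threshold into array `2`, and after them the
index of the constant `1`. -/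
def selectVars : Program :=
  .seq (.assign 15 (.const 0)) <|
    .seq
      (.count 10 0 <| .seq (.store 2 (.reg 15) (.reg 10)) <|
        .assign 15 (.reg 15 +
          .lt (.reg 7) (.cell 1 (.reg 10)) * .lt (.reg 15) (.reg 4 - .const 1))) <|
      .store 2 (.reg 4 - .const 1) (.reg 0 + .const 1)

/-- What the selected variables have to satisfy. -/
structure Selects (n B : ℕ) (p : ℕ → Prop) [DecidablePred p] (R : ℕ → ℕ) : Prop where
  range : ∀ j, R j < n ∨ R j = n + 1
  last : R (B - 1) = n + 1
  complete : Nat.count p n ≤ B - 1 → ∀ i < n, p i → ∃ j < B - 1, R j = i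

theorem selectVars_halts (hl : 1 ≤ l) (h : Ready P n l σ) (hn : 1 ≤ n)
    (hnl : (n + 1).size ≤ l) (ha : ∀ i, σ.arr 2 i = 0) {p : ℕ → Prop} [DecidablePred p]
    (hp : ∀ i < n, p i ↔ P.agreeThreshold < σ.arr 1 i) :
    Halts O l selectVars σ ((n + 1) * 200) fun τ =>
      Ready P n l τ ∧ τ.drawn = σ.drawn ∧ τ.arr 3 = σ.arr 3 ∧
      Selects n P.base p (τ.arr 2) := by
  have h1 := h.setReg (r := 15) (v := 0) (by norm_num) (by simp)
  have hB : P.base.size ≤ l := h.base ▸ h.bounded.reg 4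
  refine .assign_seq h.bounded hl (by simp only [Expr.weight]; omega) <|
    .seq ((n + 1) * 170) (by simp only [Expr.weight]; omega) <| .mono
    (.count (c := (n + 1) * 170) 150 (I := fun i τ => Ready P n l τ ∧ τ.reg 10 = i ∧
      τ.drawn = σ.drawn ∧ τ.arr 1 = σ.arr 1 ∧ τ.arr 3 = σ.arr 3 ∧ (∀ j, τ.arr 2 j < n) ∧
      τ.reg 15 ≤ P.base - 1 ∧ (P.base - 1 < Nat.count p i ∨ (τ.reg 15 = Nat.count p i ∧
      ∀ i' < i, p i' → ∃ j < τ.reg 15, τ.arr 2 j = i'))) (N := n) hl (by omega) ?_ ?_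
      fun i hi τ hτ => ?_) le_rfl ?_
  · rintro j τ ⟨h1, h2, -⟩
    exact ⟨h1.bounded, h2, h1.dim⟩
  · refine ⟨h1.setReg (by norm_num) (by simp), by simp, rfl, rfl, rfl, fun j => ?_, by simp,
      .inr (by simp)⟩
    simp only [State.setReg_arr, ha]; omega
  · obtain ⟨g1, g2, g3, g4, g5, g6, g7, g8⟩ := hτ
    have hin : i.size ≤ l := (Nat.size_le_size (by omega)).trans hnl
    obtain ⟨q, hq⟩ : ∃ q, τ.reg 15 = q := ⟨_, rfl⟩
    obtain ⟨υ, hυ⟩ : ∃ υ, υ = τ.setCell 2 q i := ⟨_, rfl⟩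
    have g9 : Ready P n l υ := hυ ▸ g1.setCell (by norm_num) hin
    rw [hq] at g7 g8
    have d2 : υ.reg 10 = i := by rw [hυ]; exact g2
    have d3 : υ.reg 15 = q := by rw [hυ]; exact hq
    have d4 : υ.arr 1 = σ.arr 1 := (funext fun j => by simp [hυ]).trans g4
    have d5 : υ.arr 3 = σ.arr 3 := (funext fun j => by simp [hυ]).trans g5
    have d6 : ∀ j, υ.arr 2 j = if j = q then i else τ.arr 2 j := fun j => by simp [hυ]
    have d7 : υ.drawn = σ.drawn := by rw [hυ]; exact g3
    have hv : (Expr.reg 15 + .lt (.reg 7) (.cell 1 (.reg 10)) *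
        .lt (.reg 15) (.reg 4 - .const 1)).eval υ =
        if p i ∧ q < P.base - 1 then q + 1 else q := by
      simp only [Expr.eval_add, Expr.eval_mul, Expr.eval_sub, Expr.eval_const, Expr.eval_lt,
        Expr.eval_cell, Expr.eval_reg, g9.base, g9.agreeThreshold, d2, d3, d4, ← hp i hi]
      by_cases h1 : p i <;> by_cases h2 : q < P.base - 1 <;> simp [h1, h2]
    have hqs : (if p i ∧ q < P.base - 1 then q + 1 else q).size ≤ l :=
      (Nat.size_le_size (by split_ifs <;> omega)).trans hB
    have g10 := g9.setReg (r := 15) (by norm_num) hqs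
    refine .store_seq g1.bounded hl (by decide) ?_
    simp only [Expr.eval_reg, g2, hq]
    rw [← hυ]
    refine .assign g9.bounded hl (by decide) ?_
    rw [hv]
    refine ⟨g10.bounded, by simpa using d2, g10.setReg (by norm_num)
      ((Nat.size_le_size (by omega)).trans hnl), by simp, d7, d4, d5, fun j => ?_, ?_, ?_⟩
    · simp only [State.setReg_arr, d6]
      split_ifs
      · exact hi
      · exact g6 j
    · simp only [State.setReg_reg, Nat.reduceEqDiff, reduceIte]
      split_ifs <;> omega
    · simp only [State.setReg_reg, Nat.reduceEqDiff, reduceIte, State.setReg_arr, d6,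
        Nat.count_succ]
      rcases g8 with g8 | ⟨g8, g8'⟩
      · left; omega
      by_cases hpi : p i
      · by_cases hqr : q < P.base - 1
        · right
          simp only [hpi, hqr, and_self, if_true]
          refine ⟨by omega, fun i' hi' hpi' => ?_⟩
          rcases Nat.lt_succ_iff_lt_or_eq.1 hi' with h' | rfl
          · obtain ⟨j, hj, rfl⟩ := g8' i' h' hpi'
            exact ⟨j, by omega, by rw [if_neg (by omega)]⟩
          · exact ⟨q, by omega, by simp⟩
        · left
          simp only [hpi, if_true]
          omega
      · right
        simp only [hpi, false_and, if_false]
        refine ⟨g8, fun i' hi' hpi' => ?_⟩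
        rcases Nat.lt_succ_iff_lt_or_eq.1 hi' with h' | rfl
        · obtain ⟨j, hj, rfl⟩ := g8' i' h' hpi'
          exact ⟨j, by omega, by rw [if_neg (by omega)]⟩
        · exact absurd hpi' hpi
  · rintro τ ⟨g1, g2, g3, g4, g5, g6, g7, g8⟩
    refine .store g1.bounded hl ?_ ?_
    · have e : (Expr.reg 4 - .const 1).weight = 8 := rfl
      have e' : (Expr.reg 0 + .const 1).weight = 8 := rfl
      rw [e, e']; simp only [Expr.weight]; omega
    have e : (Expr.reg 0 + .const 1).eval τ = n + 1 := by simp [g1.dim]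
    have e' : (Expr.reg 4 - .const 1).eval τ = P.base - 1 := by simp [g1.base]
    rw [e, e']
    refine ⟨g1.setCell (by norm_num) hnl, g3, ?_, ⟨fun j => ?_, by simp, fun hc i hi hpi => ?_⟩⟩
    · rw [← g5]; funext j; simp
    · simp only [State.setCell_arr, true_and]
      split_ifs
      · exact .inr rfl
      · exact .inl (g6 j)
    · obtain ⟨-, h'⟩ := g8.resolve_left (not_lt.2 hc)
      obtain ⟨j, hj, rfl⟩ := h' i hi hpi
      exact ⟨j, by omega, by simp only [State.setCell_arr, true_and]; rw [if_neg (by omega)]⟩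

/-- The point satisfies the conjunction with number `t`. -/
def Params.Sat (P : Params) (R : ℕ → ℕ) (t : ℕ) (x : Cube n) : Prop :=
  ∀ d < P.width, lookup x (R (t / P.base ^ d % P.base)) = true

instance (R : ℕ → ℕ) (t : ℕ) (x : Cube n) : Decidable (P.Sat R t x) := by
  unfold Params.Sat; infer_instance

theorem runConjunction_halts_of_load (hl : 1 ≤ l) (h : Ready P n l σ) (x : Cube n)
    (hx : ∀ i < n, σ.arr 0 i = (lookup x i).toNat)
    (hR : ∀ j, σ.arr 2 j < n ∨ σ.arr 2 j = n + 1) :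
    Halts O l runConjunction σ ((P.width + 1) * 200) fun τ =>
      Ready P n l τ ∧ (∀ r, r < 11 ∨ 13 < r → τ.reg r = σ.reg r) ∧ τ.arr = σ.arr ∧
      τ.drawn = σ.drawn ∧ τ.reg 13 = if P.Sat (σ.arr 2) (σ.reg 10) x then 1 else 0 := by
  refine runConjunction_halts hl h (fun d => lookup x (σ.arr 2 (σ.reg 10 / P.base ^ d % P.base)))
    fun d _ => ?_
  rcases hR (σ.reg 10 / P.base ^ d % P.base) with h' | h'
  · rw [hx _ h']
  · rw [h', h.one]; simp [lookup]

/-- The number of those among the `m` examples after the first `a` that are negative and satisfy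
the conjunction with number `t`. -/
def badCount (O : Oracles n) (P : Params) (R : ℕ → ℕ) (a m t : ℕ) : ℕ :=
  Nat.count (fun j => O.target (O.point (a + j)) = false ∧ P.Sat R t (O.point (a + j))) m

/-- Count, for every conjunction, the negative examples that satisfy it, in array `3`. -/
def tallyBad : Program :=
  .count 9 6 <| .seq .sample <| .count 10 5 <| .seq runConjunction <|
    .store 3 (.reg 10) (.cell 3 (.reg 10) + .reg 13 * .lt (.cell 0 (.reg 0)) (.const 1))

theorem tallyBad_halts (hl : 1 ≤ l) (h : Ready P n l σ) (ha : ∀ i, σ.arr 3 i = 0)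
    (hR : ∀ j, σ.arr 2 j < n ∨ σ.arr 2 j = n + 1) :
    Halts O l tallyBad σ ((P.samples + 1) * ((n + 1) * 40 + (P.terms + 1) * ((P.width + 1) * 300)))
      fun τ => Ready P n l τ ∧ τ.arr 2 = σ.arr 2 ∧
        ∀ t < P.terms, τ.arr 3 t = badCount O P (σ.arr 2) σ.drawn P.samples t := by
  have hn : n.size ≤ l := h.dim ▸ h.bounded.reg 0
  have hm : P.samples.size ≤ l := h.samples ▸ h.bounded.reg 6
  have hN : P.terms.size ≤ l := h.terms ▸ h.bounded.reg 5
  set R := σ.arr 2 with hRdef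
  refine .mono (.count (c := _)
    ((n + 1) * 2 + (P.terms + 1) * ((P.width + 1) * 300))
    (I := fun m τ => Ready P n l τ ∧ τ.reg 9 = m ∧ τ.drawn = σ.drawn + m ∧ τ.arr 2 = R ∧
      ∀ t < P.terms, τ.arr 3 t = badCount O P R σ.drawn m t) (N := P.samples) hl
    (Nat.mul_le_mul_left _ (by omega)) ?_ ?_ fun m hm' τ hτ => ?_) le_rfl ?_
  · rintro j τ ⟨h1, h2, -⟩
    exact ⟨h1.bounded, h2, h1.samples⟩
  · exact ⟨h.setReg (by norm_num) (by simp), by simp, rfl, rfl, by simp [ha, badCount]⟩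
  · obtain ⟨g1, g2, g3, g4, g5⟩ := hτ
    refine .seq ((n + 1) * 2) (by omega) (.sample hn hl ?_)
    rw [g3]
    set x := O.point (σ.drawn + m) with hx
    set b := O.target x with hb
    have g7 := (g1.load hl x b).draw (σ.drawn + m + 1)
    set υ : State := { τ.load x b with drawn := σ.drawn + m + 1 } with hυ
    have e0 : υ.arr 0 = (τ.load x b).arr 0 := rfl
    have e2 : υ.arr 2 = τ.arr 2 := State.load_arr_of_ne (a := 2) τ x b (by norm_num)
    have e3 : υ.arr 3 = τ.arr 3 := State.load_arr_of_ne (a := 3) τ x b (by norm_num)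
    refine .mono (.count (c := (P.terms + 1) * ((P.width + 1) * 300)) ((P.width + 1) * 260)
      (I := fun t τ' => Ready P n l τ' ∧ τ'.reg 10 = t ∧ τ'.reg 9 = m ∧
        τ'.drawn = σ.drawn + m + 1 ∧ τ'.arr 0 = υ.arr 0 ∧ τ'.arr 2 = R ∧
        (∀ t' < t, τ'.arr 3 t' = badCount O P R σ.drawn (m + 1) t') ∧
        ∀ t' < P.terms, t ≤ t' → τ'.arr 3 t' = badCount O P R σ.drawn m t') (N := P.terms) hl
      (Nat.mul_le_mul_left _ (by omega)) ?_ ?_ fun t ht τ' hτ' => ?_) (by omega) ?_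
    · rintro j τ ⟨h1, h2, -⟩
      exact ⟨h1.bounded, h2, h1.terms⟩
    · exact ⟨g7.setReg (by norm_num) (by simp), by simp, by simpa [hυ] using g2, rfl, rfl,
        e2.trans g4, by simp, fun t ht _ => (congrFun e3 t).trans (g5 t ht)⟩
    · obtain ⟨k1, k2, k3, k4, k5, k6, k7, k8⟩ := hτ'
      refine .seq ((P.width + 1) * 200) (by omega) <|
        (runConjunction_halts_of_load hl k1 x (fun i hi => ?_) (by rw [k6]; exact hR)).mono le_rfl ?_
      · rw [k5, e0, State.load_arr_lt _ _ _ hi]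
      rintro τ₁ ⟨r1, r2, r3, r4, r5⟩
      rw [k6, k2] at r5
      have hv : (Expr.cell 3 (.reg 10) + .reg 13 * .lt (.cell 0 (.reg 0)) (.const 1)).eval τ₁ =
          badCount O P R σ.drawn (m + 1) t := by
        simp only [Expr.eval_add, Expr.eval_mul, Expr.eval_cell, Expr.eval_reg, Expr.eval_lt,
          Expr.eval_const, r5, r1.dim, r3, r2 10 (by norm_num), k2, k5, e0, State.load_arr_dim,
          k8 t ht le_rfl, badCount, Nat.count_succ, ← hx, ← hb]
        congr 1
        by_cases hs : P.Sat R t x <;> cases b <;> simp [hs]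
      have hs : (badCount O P R σ.drawn (m + 1) t).size ≤ l :=
        (Nat.size_le_size ((Nat.count_le _).trans hm')).trans hm
      have k10 := r1.setCell (a := 3) (i := t) (by norm_num) hs
      refine .store r1.bounded hl ?_ ?_
      · have e : (Expr.cell 3 (.reg 10) +
          .reg 13 * .lt (.cell 0 (.reg 0)) (.const 1)).weight ≤ 50 := by decide
        have e' : (Expr.reg 10).weight = 2 := rfl
        omega
      rw [hv, Expr.eval_reg, r2 10 (by norm_num), k2]
      refine ⟨k10.bounded, ?_, k10.setReg (by norm_num) ((Nat.size_le_size ht).trans hN),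
        by simp, ?_, ?_, ?_, ?_, fun t' ht' => ?_, fun t' ht' ht2 => ?_⟩
      · simp [r2 10, k2]
      · simp [r2 9, k3]
      · simpa using r4.trans k4
      · funext a; simp [r3, k5]
      · funext a; simp [r3, k6]
      · rcases Nat.lt_succ_iff_lt_or_eq.1 ht' with h' | rfl
        · simp [h'.ne, r3, k7 t' h']
        · simp
      · simp only [State.setReg_arr, State.setCell_arr]
        rw [if_neg (by omega), r3, k8 t' ht' (by omega)]
    · rintro τ' ⟨k1, k2, k3, k4, k5, k6, k7, k8⟩
      exact ⟨k1.bounded, k3, k1.setReg (by norm_num) ((Nat.size_le_size hm').trans hm), by simp,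
        k4, k6, k7⟩
  · rintro τ ⟨h1, -, -, h2, h3⟩
    exact ⟨h1, h2, h3⟩

/-- Evaluate the disjunction of all conjunctions whose counter in array `3` is small. -/
def evalHypothesis : Program :=
  .seq (.assign 14 (.const 0)) <|
    .seq
      (.count 10 5 <| .seq runConjunction <|
        .assign 14 (.reg 14 + .reg 13 * .lt (.cell 3 (.reg 10)) (.reg 8 + .const 1))) <|
      .assign 0 (.reg 14)

theorem evalHypothesis_halts (hl : 1 ≤ l) (h : Ready P n l σ)
    (hR : ∀ j, σ.arr 2 j < n ∨ σ.arr 2 j = n + 1) (x : Cube n) :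
    Halts O l evalHypothesis (σ.load x false) ((P.terms + 1) * ((P.width + 1) * 320)) fun τ =>
      (τ.reg 0 ≠ 0 ↔ ∃ t < P.terms, σ.arr 3 t ≤ P.badThreshold ∧ P.Sat (σ.arr 2) t x) := by
  have hN : P.terms.size ≤ l := h.terms ▸ h.bounded.reg 5
  have h0 := h.load hl x false
  have h1 := h0.setReg (r := 14) (v := 0) (by norm_num) (by simp)
  set p : ℕ → Prop := fun t => σ.arr 3 t ≤ P.badThreshold ∧ P.Sat (σ.arr 2) t x with hp
  have e2 : (σ.load x false).arr 2 = σ.arr 2 :=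
    State.load_arr_of_ne σ x false (by norm_num)
  have e3 : (σ.load x false).arr 3 = σ.arr 3 :=
    State.load_arr_of_ne σ x false (by norm_num)
  have hT' : (P.terms + 1) * ((P.width + 1) * 300) + 10 ≤
      (P.terms + 1) * ((P.width + 1) * 320) := by nlinarith
  refine .assign_seq h0.bounded hl (by simp only [Expr.weight]; omega) <|
    .seq ((P.terms + 1) * ((P.width + 1) * 300)) (by simp only [Expr.weight]; omega) <| .mono
    (.count (c := (P.terms + 1) * ((P.width + 1) * 300)) ((P.width + 1) * 270)
      (I := fun t τ => Ready P n l τ ∧ τ.reg 10 = t ∧ τ.arr = (σ.load x false).arr ∧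
      τ.reg 14 = Nat.count p t) (N := P.terms) hl (Nat.mul_le_mul_left _ (by omega)) ?_ ?_
      fun t ht τ hτ => ?_) le_rfl ?_
  · rintro j τ ⟨h1, h2, -⟩
    exact ⟨h1.bounded, h2, h1.terms⟩
  · exact ⟨h1.setReg (by norm_num) (by simp), by simp, rfl, by simp⟩
  · obtain ⟨g1, g2, g3, g4⟩ := hτ
    refine .seq ((P.width + 1) * 200) (by omega) <|
      (runConjunction_halts_of_load hl g1 x (fun i hi => ?_) (by rw [g3, e2]; exact hR)).mono le_rfl ?_
    · rw [g3, State.load_arr_lt _ _ _ hi]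
    rintro τ₁ ⟨r1, r2, r3, r4, r5⟩
    rw [g3, g2, e2] at r5
    have hv : (Expr.reg 14 + .reg 13 * .lt (.cell 3 (.reg 10)) (.reg 8 + .const 1)).eval τ₁ =
        Nat.count p (t + 1) := by
      simp only [Expr.eval_add, Expr.eval_mul, Expr.eval_cell, Expr.eval_reg, Expr.eval_lt,
        Expr.eval_const, r5, r1.badThreshold, r3, r2 10 (by norm_num), r2 14 (by norm_num), g2,
        g3, e3, g4, Nat.count_succ, Nat.lt_succ_iff]
      congr 1
      by_cases hs : P.Sat (σ.arr 2) t x <;> simp [p, hs]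
    have hs : (Nat.count p (t + 1)).size ≤ l :=
      (Nat.size_le_size ((Nat.count_le _).trans ht)).trans hN
    have k10 := r1.setReg (r := 14) (by norm_num) hs
    refine .assign r1.bounded hl ?_ ?_
    · have e : (Expr.reg 14 +
          .reg 13 * .lt (.cell 3 (.reg 10)) (.reg 8 + .const 1)).weight ≤ 60 := by decide
      omega
    rw [hv]
    refine ⟨k10.bounded, ?_, k10.setReg (by norm_num) ((Nat.size_le_size ht).trans hN), by simp,
      ?_, by simp⟩
    · simp [r2 10, g2]
    · exact r3.trans g3
  · rintro τ ⟨g1, g2, g3, g4⟩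
    refine .assign g1.bounded hl (by simp only [Expr.weight]; omega) ?_
    simp only [State.setReg_reg, Expr.eval_reg, reduceIte, g4, Nat.count_ne_iff_exists, p]

end Phases

/-! ## The parameters and the learner -/

/-- The width of the conjunctions that the learner considers. -/
def termWidth (s k : ℕ) : ℕ := Nat.clog 2 (4 * (s * k))

/-- One more than the largest number of variables that the learner considers. -/
def termBase (s k : ℕ) : ℕ := 16 * ((s * termWidth s k) * (s * termWidth s k)) + 1

/-- The number of conjunctions that the learner considers. -/
def termCount (s k : ℕ) : ℕ := termBase s k ^ termWidth s k

/-- The reciprocal of the influence below which a variable is irrelevant. -/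
def resolution (s k : ℕ) : ℕ := 32 * (k * (termCount s k * (termBase s k - 1)))

/-- The bound for the deviation of all counts from their means. -/
def deviation (n s k : ℕ) : ℕ :=
  4 * resolution s k * (Nat.clog 2 (n + 1) * (termWidth s k + 1) + 1)

/-- The numbers that the learner computes from its input. -/
def params (n s k : ℕ) : Params where
  width := termWidth s k
  base := termBase s k
  terms := termCount s k
  samples := 8 * resolution s k * deviation n s k
  agreeThreshold := 4 * resolution s k * deviation n s k + 3 * deviation n s k
  badThreshold := 16 * ((termBase s k - 1) * deviation n s k) + deviation n s k

/-- A bound for all numbers that occur in a run. -/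
def maxValue (n s k : ℕ) : ℕ := (params n s k).samples + 2 * (n + 1)

section Bounds
variable {n s k : ℕ}

theorem two_le_termWidth (hs : 1 ≤ s) (hk : 1 ≤ k) : 2 ≤ termWidth s k :=
  (Nat.lt_clog_iff_pow_lt (by norm_num)).2 (by have := Nat.mul_le_mul hs hk; omega)

theorem le_base_sub_one (hs : 1 ≤ s) (hk : 1 ≤ k) :
    32 * s ≤ termBase s k - 1 ∧ 32 * termWidth s k ≤ termBase s k - 1 := by
  have hw := two_le_termWidth hs hk
  simp only [termBase, Nat.add_sub_cancel]
  set w := termWidth s k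
  have h1 : s * 2 ≤ s * w := Nat.mul_le_mul_left _ hw
  have h2 : 1 * w ≤ s * w := Nat.mul_le_mul_right _ hs
  constructor <;> nlinarith

theorem one_le_termCount (s k : ℕ) : 1 ≤ termCount s k :=
  Nat.one_le_pow _ _ (Nat.succ_pos _)

theorem resolution_ge (hs : 1 ≤ s) (hk : 1 ≤ k) :
    32 * k * s ≤ resolution s k ∧ 32 * termCount s k ≤ resolution s k ∧
      32 * termBase s k ≤ 2 * resolution s k ∧ 32 * (termBase s k - 1) ≤ resolution s k := by
  have hN := one_le_termCount s k
  obtain ⟨h1, h2⟩ := le_base_sub_one hs hk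
  unfold resolution
  obtain ⟨r, hr⟩ : ∃ r, r = termBase s k - 1 := ⟨_, rfl⟩
  have hB : termBase s k = r + 1 := by rw [hr]; simp [termBase]
  rw [← hr] at h1 ⊢
  set N := termCount s k
  have h3 : 1 * s ≤ N * r := Nat.mul_le_mul hN (by omega)
  have h4 : N * 1 ≤ N * r := Nat.mul_le_mul le_rfl (by omega)
  have h5 : 1 * r ≤ N * r := Nat.mul_le_mul hN le_rfl
  have h6 : 1 * (N * r) ≤ k * (N * r) := Nat.mul_le_mul hk le_rfl
  refine ⟨?_, by omega, by omega, by omega⟩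
  rw [mul_assoc]
  exact Nat.mul_le_mul_left _ (Nat.mul_le_mul_left _ (by omega))

theorem resolution_le_deviation (n s k : ℕ) :
    4 * resolution s k ≤ deviation n s k := Nat.le_mul_of_pos_right _ (Nat.succ_pos _)

theorem params_le (hs : 1 ≤ s) (hk : 1 ≤ k) :
    let m := (params n s k).samples
    2 * (4 * (s * k)) ≤ m ∧ termWidth s k ≤ m ∧ termBase s k ≤ m ∧ termCount s k ≤ m ∧
      resolution s k ≤ m ∧ deviation n s k ≤ m ∧ (params n s k).agreeThreshold ≤ m ∧
      (params n s k).badThreshold ≤ m := by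
  obtain ⟨h1, h2, h3, h4⟩ := resolution_ge hs hk
  obtain ⟨h5, h6⟩ := le_base_sub_one hs hk
  have h7 := resolution_le_deviation n s k
  simp only [params]
  set E := resolution s k
  set u := deviation n s k
  have hE : 1 ≤ E := by have := one_le_termCount s k; omega
  have h8 : 8 * u ≤ 8 * E * u := Nat.mul_le_mul_right _ (by omega)
  have h9 : s * k = k * s := mul_comm _ _
  have h10 : E ≤ 8 * E * u := by omega
  refine ⟨by rw [mul_assoc] at h1; omega, by omega, by omega, by omega, by omega, by omega, ?_, ?_⟩
  · nlinarith
  · have : 32 * (termBase s k - 1) * u ≤ E * u := Nat.mul_le_mul_right _ h4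
    nlinarith

end Bounds

/-- Compute the binary logarithm, rounded up, of register `x` in register `r`. -/
def logLoop (x r : ℕ) : Program :=
  .seq (.assign r (.const 0)) <| .seq (.assign 10 (.const 1)) <| .count 11 x <|
    .seq (.assign r (.reg r + .lt (.reg 10) (.reg x)))
      (.assign 10 (.reg 10 + .reg 10 * .lt (.reg 10) (.reg x)))

section Setup
variable {n l : ℕ} {O : Oracles n} {σ : State}

theorem logLoop_halts {x r v : ℕ} (hl : 1 ≤ l) (h : σ.Bounded l) (hx : σ.reg x = v)
    (hv : (2 * v).size ≤ l) (hxr : x ≠ r ∧ x ≠ 10 ∧ x ≠ 11) (hr : r ≠ 10 ∧ r ≠ 11) :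
    Halts O l (logLoop x r) σ ((v + 1) * 150) fun τ => τ.Bounded l ∧ τ.arr = σ.arr ∧
      τ.drawn = σ.drawn ∧ (∀ i, i ≠ r → i ≠ 10 → i ≠ 11 → τ.reg i = σ.reg i) ∧
      τ.reg r = Nat.clog 2 v := by
  obtain ⟨hx1, hx2, hx3⟩ := hxr
  obtain ⟨hr1, hr2⟩ := hr
  have hvl : v.size ≤ l := hx ▸ h.reg x
  have h1 := h.setReg (r := r) (v := 0) (by simp)
  have h2 := h1.setReg (r := 10) (v := 1) (by simpa using hl)
  have hcv : Nat.clog 2 v ≤ v := Nat.clog_le_of_le_pow Nat.lt_two_pow_self.le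
  refine .assign_seq h hl (by simp only [Expr.weight]; omega) <|
    .assign_seq h1 hl (by simp only [Expr.weight]; omega) <| .mono
    (.count (c := (v + 1) * 140) 120 (I := fun j τ => τ.Bounded l ∧ τ.reg 11 = j ∧
      (∀ i, i ≠ r → i ≠ 10 → i ≠ 11 → τ.reg i = σ.reg i) ∧ τ.arr = σ.arr ∧
      τ.drawn = σ.drawn ∧ τ.reg r = min j (Nat.clog 2 v) ∧
      τ.reg 10 = 2 ^ min j (Nat.clog 2 v)) (N := v) hl (by omega) ?_ ?_
      fun j hj τ hτ => ?_) (by simp only [Expr.weight]; omega) ?_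
  · rintro j τ ⟨h1, h2, h3, -⟩
    exact ⟨h1, h2, (h3 x hx1 hx2 hx3).trans hx⟩
  · refine ⟨h2.setReg (by simp), by simp, fun i h1 h2 h3 => by simp [h1, h2, h3], rfl, rfl,
      by simp [hr1, hr2], by simp⟩
  · obtain ⟨g1, g2, g3, g4, g5, g6, g7⟩ := hτ
    have gx : τ.reg x = v := (g3 x hx1 hx2 hx3).trans hx
    have hlt : 2 ^ min j (Nat.clog 2 v) < v ↔ j < Nat.clog 2 v := by
      rw [← Nat.lt_clog_iff_pow_lt (by norm_num)]; omega
    have e1 : (Expr.reg r + .lt (.reg 10) (.reg x)).eval τ = min (j + 1) (Nat.clog 2 v) := by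
      simp only [Expr.eval_add, Expr.eval_reg, Expr.eval_lt, g6, g7, gx, hlt]
      split_ifs <;> omega
    have s1 : (min (j + 1) (Nat.clog 2 v)).size ≤ l :=
      (Nat.size_le_size ((min_le_right _ _).trans hcv)).trans hvl
    have g8 := g1.setReg (r := r) s1
    have e2 : (Expr.reg 10 + .reg 10 * .lt (.reg 10) (.reg x)).eval
        (τ.setReg r (min (j + 1) (Nat.clog 2 v))) = 2 ^ min (j + 1) (Nat.clog 2 v) := by
      simp only [Expr.eval_add, Expr.eval_mul, Expr.eval_reg, Expr.eval_lt, State.setReg_reg,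
        hr1.symm, hx1, reduceIte, g7, gx, hlt]
      split_ifs with hc
      · rw [min_eq_left hc.le, min_eq_left (Nat.succ_le_of_lt hc), Nat.succ_eq_add_one]; ring
      · rw [min_eq_right (not_lt.1 hc), min_eq_right (by omega)]; ring
    have s2 : (2 ^ min (j + 1) (Nat.clog 2 v)).size ≤ l := by
      by_cases hc : j < Nat.clog 2 v
      · refine (Nat.size_le_size ?_).trans hv
        have := hlt.2 hc
        rw [min_eq_left hc.le] at this
        rw [min_eq_left (Nat.succ_le_of_lt hc), pow_succ]
        omega
      · have := g1.reg 10
        rw [g7] at this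
        rwa [min_eq_right (by omega), ← min_eq_right (not_lt.1 hc)]
    have g9 := g8.setReg (r := 10) s2
    refine .assign_seq g1 hl (Nat.le_of_ble_eq_true rfl) ?_
    rw [e1]
    refine .assign g8 hl (Nat.le_of_ble_eq_true rfl) ?_
    rw [e2]
    refine ⟨g9, by simp [hr2.symm, g2], g9.setReg ((Nat.size_le_size hj).trans hvl), by simp,
      fun i h1 h2 h3 => by simp [h1, h2, h3, g3], g4, g5, by simp [hr1, hr2], by simp⟩
  · rintro τ ⟨h1, -, h2, h3, h4, h5, -⟩
    exact ⟨h1, h3, h4, h2, by rw [h5, min_eq_right hcv]⟩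

/-- Compute a power of register `4` with exponent in register `3`, in register `5`. -/
def powLoop : Program :=
  .seq (.assign 5 (.const 1)) (.count 11 3 (.assign 5 (.reg 5 * .reg 4)))

theorem powLoop_halts {w B : ℕ} (hl : 1 ≤ l) (h : σ.Bounded l) (hw : σ.reg 3 = w)
    (hB : σ.reg 4 = B) (hB1 : 1 ≤ B) (hv : (B ^ w).size ≤ l) :
    Halts O l powLoop σ ((w + 1) * 50) fun τ => τ.Bounded l ∧ τ.arr = σ.arr ∧
      τ.drawn = σ.drawn ∧ (∀ i, i ≠ 5 → i ≠ 11 → τ.reg i = σ.reg i) ∧ τ.reg 5 = B ^ w := by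
  have h1 := h.setReg (r := 5) (v := 1) (by simpa using hl)
  refine .assign_seq h hl (by simp only [Expr.weight]; omega) <| .mono
    (.count (c := (w + 1) * 40) 20 (I := fun j τ => τ.Bounded l ∧ τ.reg 11 = j ∧
      (∀ i, i ≠ 5 → i ≠ 11 → τ.reg i = σ.reg i) ∧ τ.arr = σ.arr ∧
      τ.drawn = σ.drawn ∧ τ.reg 5 = B ^ j) (N := w) hl (by omega) ?_ ?_
      fun j hj τ hτ => ?_) (by simp only [Expr.weight]; omega) ?_
  · rintro j τ ⟨h1, h2, h3, -⟩
    exact ⟨h1, h2, (h3 3 (by norm_num) (by norm_num)).trans hw⟩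
  · exact ⟨h1.setReg (by simp), by simp, fun i h1 h2 => by simp [h1, h2], rfl, rfl, by simp⟩
  · obtain ⟨g1, g2, g3, g4, g5, g6⟩ := hτ
    have e1 : (Expr.reg 5 * .reg 4).eval τ = B ^ (j + 1) := by
      simp [g6, g3 4, hB, pow_succ]
    have g7 := g1.setReg (r := 5)
      ((Nat.size_le_size (Nat.pow_le_pow_right hB1 (Nat.succ_le_of_lt hj))).trans hv)
    refine .assign g1 hl (by decide) ?_
    rw [e1]
    have hwl : w.size ≤ l := hw ▸ h.reg 3
    exact ⟨g7, by simp [g2], g7.setReg ((Nat.size_le_size hj).trans hwl), by simp,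
      fun i h1 h2 => by simp [h1, h2, g3], g4, g5, by simp⟩
  · rintro τ ⟨h1, -, h2, h3, h4, h5⟩
    exact ⟨h1, h3, h4, h2, h5⟩

/-- Compute the parameters. -/
def setup : Program :=
  .seq (.assign 9 (.const 4 * (.reg 1 * .reg 2))) <| .seq (logLoop 9 3) <|
  .seq (.assign 9 (.reg 0 + .const 1)) <| .seq (logLoop 9 12) <|
  .seq (.assign 4 (.const 16 * ((.reg 1 * .reg 3) * (.reg 1 * .reg 3)) + .const 1)) <|
  .seq powLoop <|
  .seq (.assign 13 (.const 32 * (.reg 2 * (.reg 5 * (.reg 4 - .const 1))))) <|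
  .seq (.assign 14 (.const 4 * .reg 13 * (.reg 12 * (.reg 3 + .const 1) + .const 1))) <|
  .seq (.assign 6 (.const 8 * .reg 13 * .reg 14)) <|
  .seq (.assign 7 (.const 4 * .reg 13 * .reg 14 + .const 3 * .reg 14)) <|
  .seq (.assign 8 (.const 16 * ((.reg 4 - .const 1) * .reg 14) + .reg 14)) <|
  .store 0 (.reg 0 + .const 1) (.const 1)

theorem setup_halts {s k : ℕ} (hs : 1 ≤ s) (hk : 1 ≤ k) (hM : (maxValue n s k).size ≤ l) :
    Halts O l setup (inputState n s k)
      ((4 * (s * k) + n + termWidth s k + 1) * 10000) fun τ => Ready (params n s k) n l τ ∧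
      τ.drawn = 0 ∧ ∀ a i, a ≠ 0 → τ.arr a i = 0 := by
  have hM' : ∀ v, v ≤ maxValue n s k → v.size ≤ l := fun v hv => (Nat.size_le_size hv).trans hM
  obtain ⟨b1, b2, b3, b4, b5, b6, b7, b8⟩ := params_le (n := n) hs hk
  have hk' : k ≤ s * k := Nat.le_mul_of_pos_left _ hs
  have hs' : s ≤ s * k := Nat.le_mul_of_pos_right _ hk
  have hl : 1 ≤ l := by simpa using hM' 1 (by unfold maxValue; omega)
  have hlogn : Nat.clog 2 (n + 1) ≤ n + 1 := Nat.clog_le_of_le_pow Nat.lt_two_pow_self.le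
  set σ := inputState n s k with hσ
  have s0 : σ.reg 0 = n := rfl
  have s1 : σ.reg 1 = s := rfl
  have s2 : σ.reg 2 = k := rfl
  have hσB : σ.Bounded l := by
    refine ⟨fun r => hM' _ ?_, fun a i => by simp [σ, inputState]⟩
    simp only [hσ, inputState, maxValue]
    split_ifs <;> omega
  set w := termWidth s k with hw
  obtain ⟨c, hc⟩ : ∃ c, c = (4 * (s * k) + n + w + 1) * 10000 := ⟨_, rfl⟩
  rw [← hc]
  have e1 : (Expr.const 4 * (.reg 1 * .reg 2)).eval σ = 4 * (s * k) := by simp [s1, s2]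
  have w1 : (Expr.const 4 * (.reg 1 * .reg 2)).weight = 33 := rfl
  have t1 := hσB.setReg (r := 9) (hM' (4 * (s * k)) (by unfold maxValue; omega))
  refine .assign_seq hσB hl (by omega) ?_
  rw [e1, w1]
  refine .seq ((4 * (s * k) + 1) * 150) (by omega) <|
    (logLoop_halts hl t1 (by simp) (hM' _ (by unfold maxValue; omega)) (by norm_num)
      (by norm_num)).mono le_rfl ?_
  rintro σ₁ ⟨t2, a2, d2, r2, c2⟩
  have r2' : ∀ i < 3, σ₁.reg i = σ.reg i := fun i hi => by
    rw [r2 i (by omega) (by omega) (by omega)]; simp; omega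
  have e3 : (Expr.reg 0 + .const 1).eval σ₁ = n + 1 := by simp [r2', s0]
  have w3 : (Expr.reg 0 + .const 1).weight = 8 := rfl
  have t3 := t2.setReg (r := 9) (hM' (n + 1) (by unfold maxValue; omega))
  refine .assign_seq t2 hl (by omega) ?_
  rw [e3, w3]
  refine .seq ((n + 1 + 1) * 150) (by omega) <|
    (logLoop_halts hl t3 (by simp) (hM' _ (by unfold maxValue; omega)) (by norm_num)
      (by norm_num)).mono le_rfl ?_
  rintro σ₂ ⟨t4, a4, d4, r4, c4⟩
  have r4' : ∀ i < 9, σ₂.reg i = σ₁.reg i := fun i hi => by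
    rw [r4 i (by omega) (by omega) (by omega)]; simp; omega
  have q3 : σ₂.reg 3 = w := (r4' 3 (by norm_num)).trans c2
  have e5 : (Expr.const 16 * ((.reg 1 * .reg 3) * (.reg 1 * .reg 3)) + .const 1).eval σ₂ =
      termBase s k := by
    simp [r4', r2', s1, c2, termBase, termWidth]
  have w5 : (Expr.const 16 * ((.reg 1 * .reg 3) * (.reg 1 * .reg 3)) + .const 1).weight ≤ 400 := by
    decide
  have t5 := t4.setReg (r := 4) (hM' (termBase s k) (by unfold maxValue; omega))
  refine .assign_seq t4 hl (by omega) ?_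
  rw [e5]
  refine .seq ((w + 1) * 50) (by omega) <|
    (powLoop_halts (B := termBase s k) hl t5 (by simpa using q3) (by simp) (Nat.succ_pos _)
      (hM' (termCount s k) (by unfold maxValue; omega))).mono le_rfl ?_
  rintro σ₃ ⟨t6, a6, d6, r6, c6⟩
  replace c6 : σ₃.reg 5 = termCount s k := c6
  have r6' : ∀ i < 4, σ₃.reg i = σ₂.reg i := fun i hi => by
    rw [r6 i (by omega) (by omega)]; simp; omega
  have q4 : σ₃.reg 4 = termBase s k := by rw [r6 4 (by omega) (by omega)]; simp
  have q0 : σ₃.reg 0 = n := by rw [r6' 0 (by norm_num), r4' 0 (by norm_num), r2' 0 (by norm_num), s0]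
  have q2 : σ₃.reg 2 = k := by rw [r6' 2 (by norm_num), r4' 2 (by norm_num), r2' 2 (by norm_num), s2]
  have q12 : σ₃.reg 12 = Nat.clog 2 (n + 1) := by
    rw [r6 12 (by norm_num) (by norm_num), State.setReg_reg, if_neg (by norm_num), c4]
  replace q3 : σ₃.reg 3 = w := (r6' 3 (by norm_num)).trans q3
  have e7 : (Expr.const 32 * (.reg 2 * (.reg 5 * (.reg 4 - .const 1)))).eval σ₃ =
      resolution s k := by simp [q2, c6, q4, resolution]
  have t7 := t6.setReg (r := 13) (hM' (resolution s k) (by unfold maxValue; omega))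
  have w7 : (Expr.const 32 * (.reg 2 * (.reg 5 * (.reg 4 - .const 1)))).weight ≤ 400 := by decide
  have w8 : (Expr.const 4 * .reg 13 * (.reg 12 * (.reg 3 + .const 1) + .const 1)).weight ≤ 400 := by
    decide
  have w9 : (Expr.const 8 * .reg 13 * .reg 14).weight ≤ 400 := by decide
  have w10 : (Expr.const 4 * .reg 13 * .reg 14 + .const 3 * .reg 14).weight ≤ 400 := by decide
  have w11 : (Expr.const 16 * ((.reg 4 - .const 1) * .reg 14) + .reg 14).weight ≤ 400 := by decide
  refine .assign_seq t6 hl (by omega) ?_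
  rw [e7]
  have e8 : (Expr.const 4 * .reg 13 * (.reg 12 * (.reg 3 + .const 1) + .const 1)).eval
      (σ₃.setReg 13 (resolution s k)) = deviation n s k := by simp [q12, q3, deviation, hw]
  have t8 := t7.setReg (r := 14) (hM' (deviation n s k) (by unfold maxValue; omega))
  refine .assign_seq t7 hl (by omega) ?_
  rw [e8]
  set σ₄ := (σ₃.setReg 13 (resolution s k)).setReg 14 (deviation n s k) with hσ₄
  have e9 : (Expr.const 8 * .reg 13 * .reg 14).eval σ₄ = (params n s k).samples := by
    simp [σ₄, params]
  have t9 := t8.setReg (r := 6) (hM' (params n s k).samples (by unfold maxValue; omega))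
  refine .assign_seq t8 hl (by omega) ?_
  rw [e9]
  have e10 : (Expr.const 4 * .reg 13 * .reg 14 + .const 3 * .reg 14).eval
      (σ₄.setReg 6 (params n s k).samples) = (params n s k).agreeThreshold := by
    simp [σ₄, params]
  have t10 := t9.setReg (r := 7) (hM' (params n s k).agreeThreshold (by unfold maxValue; omega))
  refine .assign_seq t9 hl (by omega) ?_
  rw [e10]
  set σ₅ := (σ₄.setReg 6 (params n s k).samples).setReg 7 (params n s k).agreeThreshold with hσ₅
  have e11 : (Expr.const 16 * ((.reg 4 - .const 1) * .reg 14) + .reg 14).eval σ₅ =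
      (params n s k).badThreshold := by
    simp [σ₅, σ₄, q4, params]
  have t11 := t10.setReg (r := 8) (hM' (params n s k).badThreshold (by unfold maxValue; omega))
  refine .assign_seq t10 hl (by omega) ?_
  rw [e11]
  have w12 : (Expr.const 1).weight = 2 := rfl
  refine .store t11 hl (by omega) ?_
  have e12 : (Expr.reg 0 + .const 1).eval (σ₅.setReg 8 (params n s k).badThreshold) = n + 1 := by
    simp [σ₅, σ₄, q0]
  rw [e12, Expr.eval_const]
  refine ⟨⟨t11.setCell (by simpa using hl), ?_, ?_, ?_, ?_, ?_, ?_, ?_, ?_⟩, ?_,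
    fun a i ha => ?_⟩
  · simp [σ₅, σ₄, q0]
  · simpa [σ₅, σ₄, params] using q3
  · simpa [σ₅, σ₄, params] using q4
  · simpa [σ₅, σ₄, params] using c6
  · simp [σ₅, σ₄]
  · simp [σ₅]
  · simp
  · simp
  · exact d6.trans (d4.trans d2)
  · rw [State.setCell_arr, if_neg fun h => ha h.1]
    change σ₃.arr a i = 0
    rw [a6, State.setReg_arr, a4, State.setReg_arr, a2]
    rfl

/-- The learner. -/
def learner : Program :=
  .seq setup <| .seq tallyAgreement <| .seq selectVars tallyBad

/-- A bound for the time of the learner, in multiples of the square of the word length. -/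
def learnerTime (n s k : ℕ) : ℕ :=
  (4 * (s * k) + n + termWidth s k + 1) * 10000 + ((params n s k).samples + 1) * ((n + 1) * 80) +
    (n + 1) * 200 + ((params n s k).samples + 1) *
      ((n + 1) * 40 + (termCount s k + 1) * ((termWidth s k + 1) * 300))

theorem learner_halts {s k : ℕ} (hn : 1 ≤ n) (hs : 1 ≤ s) (hk : 1 ≤ k)
    (hM : (maxValue n s k).size ≤ l) :
    Halts O l learner (inputState n s k) (learnerTime n s k) fun τ =>
      Ready (params n s k) n l τ ∧
      Selects n (termBase s k)
        (fun i => (params n s k).agreeThreshold < agreeCount O (params n s k).samples i)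
        (τ.arr 2) ∧
      ∀ t < termCount s k, τ.arr 3 t = badCount O (params n s k) (τ.arr 2)
        (params n s k).samples (params n s k).samples t := by
  have hM' : ∀ v, v ≤ maxValue n s k → v.size ≤ l := fun v hv => (Nat.size_le_size hv).trans hM
  have hl : 1 ≤ l := by simpa using hM' 1 (by unfold maxValue; omega)
  obtain ⟨T, hT⟩ : ∃ T, T = learnerTime n s k := ⟨_, rfl⟩
  rw [← hT]
  rw [learnerTime] at hT
  refine .seq _ (by omega) <| (setup_halts hs hk hM).mono le_rfl ?_
  rintro σ₁ ⟨r1, d1, z1⟩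
  refine .seq _ (by omega) <|
    (tallyAgreement_halts hl r1 d1 fun i => z1 1 i (by norm_num)).mono le_rfl ?_
  rintro σ₂ ⟨r2, d2, z2, z3, c2⟩
  refine .seq _ (by omega) <|
    (selectVars_halts hl r2 hn (hM' _ (by unfold maxValue; omega))
      (fun i => by rw [z2]; exact z1 2 i (by norm_num))
      (p := fun i => (params n s k).agreeThreshold < agreeCount O (params n s k).samples i)
      (fun i hi => by rw [c2 i hi])).mono le_rfl ?_
  rintro σ₃ ⟨r3, d3, z4, hR⟩
  refine (tallyBad_halts hl r3
    (fun i => by rw [z4, z3]; exact z1 3 i (by norm_num)) hR.range).mono ?_ ?_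
  · change _ * (_ + (termCount s k + 1) * ((termWidth s k + 1) * 300)) ≤ _
    omega
  rintro τ ⟨r4, z5, c4⟩
  rw [z5]
  refine ⟨r4, hR, fun t ht => ?_⟩
  rw [c4 t ht, d3, d2]

end Setup

/-! ## Probabilities on the cube -/

/-- The probability of a property of a uniform point. -/
noncomputable def prob {n : ℕ} (p : Cube n → Prop) : ℝ := (uniform n).real {x | p x}

section Prob
variable {n : ℕ}

theorem prob_mono {p q : Cube n → Prop} (h : ∀ x, p x → q x) : prob p ≤ prob q :=
  measureReal_mono h

theorem prob_or_le (p q : Cube n → Prop) : prob (fun x => p x ∨ q x) ≤ prob p + prob q :=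
  measureReal_union_le _ _

theorem prob_exists_le {ι : Type*} (s : Finset ι) (p : ι → Cube n → Prop) :
    prob (fun x => ∃ i ∈ s, p i x) ≤ ∑ i ∈ s, prob (p i) := by
  refine le_trans (le_of_eq ?_) (measureReal_biUnion_finset_le s fun i => {x | p i x})
  unfold prob
  congr 1
  ext x; simp

theorem prob_eq_sum (p : Cube n → Prop) [DecidablePred p] :
    prob p = (∑ x, if p x then (1 : ℝ) else 0) / 2 ^ n := by
  unfold prob uniform
  rw [measureReal_def, PMF.toMeasure_uniformOfFintype_apply (hs := (Set.toFinite _).measurableSet),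
    ENNReal.toReal_div, Finset.sum_boole, Fintype.card_subtype]
  simp

theorem prob_comp_involutive {φ : Cube n → Cube n} (hφ : Function.Involutive φ)
    (p : Cube n → Prop) : prob (fun x => p (φ x)) = prob p := by
  classical
  rw [prob_eq_sum, prob_eq_sum]
  congr 1
  exact Equiv.sum_comp hφ.toPerm fun x => if p x then (1 : ℝ) else 0

theorem prob_forall_mem (T : Finset (Fin n)) :
    prob (fun x => ∀ i ∈ T, x i = true) = (1 / 2) ^ T.card := by
  classical
  have h : (Finset.univ.filter fun x : Cube n => ∀ i ∈ T, x i = true) =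
      Fintype.piFinset fun i => if i ∈ T then {true} else Finset.univ := by
    ext x
    simp only [Finset.mem_filter, Finset.mem_univ, true_and, Fintype.mem_piFinset]
    refine forall_congr' fun i => ?_
    split_ifs with hi <;> simp [hi]
  rw [prob_eq_sum, Finset.sum_boole, h, Fintype.card_piFinset]
  have h2 : ∀ i : Fin n, (if i ∈ T then {true} else Finset.univ : Finset Bool).card =
      if i ∈ T then 1 else 2 := fun i => by split_ifs <;> simp
  have h3 : (Finset.univ.filter fun i => i ∉ T).card + T.card = n := by
    have := Finset.card_compl_add_card T
    rw [Fintype.card_fin] at this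
    refine Eq.trans ?_ this
    congr 2; ext i; simp
  rw [Finset.prod_congr rfl fun i _ => h2 i, Finset.prod_ite, Finset.prod_const_one, one_mul,
    Finset.prod_const, div_eq_iff (by positivity)]
  have h4 : (2 : ℝ) ^ n = 2 ^ ((Finset.univ.filter fun i => i ∉ T).card + T.card) := by rw [h3]
  rw [h4, pow_add]
  push_cast
  rw [mul_left_comm, ← mul_pow]
  norm_num

end Prob

/-! ## Influences -/

section Influence
variable {n : ℕ}

/-- Change one coordinate. -/
def flipAt (i : Fin n) (x : Cube n) : Cube n := Function.update x i (!x i)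

theorem flipAt_involutive (i : Fin n) : Function.Involutive (flipAt i) := fun x => by
  simp [flipAt]

/-- The influence of a variable: the probability that changing it changes the value. -/
noncomputable def influence (f : Cube n → Bool) (i : Fin n) : ℝ :=
  prob fun x => f x ≠ f (flipAt i x)

theorem prob_eq_apply {f : Cube n → Bool}
    (hf : ∀ x y : Cube n, (∀ i, x i = true → y i = true) → f x = true → f y = true) (i : Fin n) :
    prob (fun x => x i = f x) = 1 / 2 + influence f i / 2 := by
  classical
  have key : ∀ x : Cube n, ((if x i = f x then (1 : ℝ) else 0) +
      if flipAt i x i = f (flipAt i x) then 1 else 0) =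
      1 + if f x ≠ f (flipAt i x) then 1 else 0 := by
    intro x
    have hi : flipAt i x i = !x i := by simp [flipAt]
    rw [hi]
    cases hx : x i
    · have := hf x (flipAt i x) fun j hj => by
        rcases eq_or_ne j i with rfl | hji
        · rw [hx] at hj; simp at hj
        · simpa [flipAt, hji] using hj
      cases h1 : f x <;> cases h2 : f (flipAt i x) <;> simp_all
    · have := hf (flipAt i x) x fun j hj => by
        rcases eq_or_ne j i with rfl | hji
        · exact hx
        · simpa [flipAt, hji] using hj
      cases h1 : f x <;> cases h2 : f (flipAt i x) <;> simp_all
  have h1 := prob_comp_involutive (flipAt_involutive i) fun x => x i = f x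
  have h2 : prob (fun x => x i = f x) + prob (fun x => flipAt i x i = f (flipAt i x)) =
      1 + influence f i := by
    rw [influence, prob_eq_sum, prob_eq_sum, prob_eq_sum, ← add_div, ← Finset.sum_add_distrib,
      Finset.sum_congr rfl fun x _ => key x, Finset.sum_add_distrib, add_div]
    simp
  linarith

theorem influence_le (f g : Cube n → Bool) (i : Fin n) :
    influence g i ≤ influence f i + 2 * prob fun x => f x ≠ g x := by
  have h1 := prob_comp_involutive (flipAt_involutive i) fun x => f x ≠ g x
  have h2 : influence g i ≤
      prob fun x => f x ≠ f (flipAt i x) ∨ f x ≠ g x ∨ f (flipAt i x) ≠ g (flipAt i x) :=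
    prob_mono fun x hx => by
      by_contra! h
      exact hx (h.2.1 ▸ h.2.2 ▸ h.1)
  have h3 := prob_or_le (fun x => f x ≠ f (flipAt i x)) fun x =>
    f x ≠ g x ∨ f (flipAt i x) ≠ g (flipAt i x)
  have h4 := prob_or_le (fun x => f x ≠ g x) fun x => f (flipAt i x) ≠ g (flipAt i x)
  unfold influence at *
  linarith

/-- The point `x` with the coordinates in `S` taken from `y`. -/
def mix (S : Finset (Fin n)) (x y : Cube n) : Cube n := fun i => if i ∈ S then y i else x i

theorem sum_ne_mix_le (f : Cube n → Bool) (S : Finset (Fin n)) :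
    ∑ z : Cube n × Cube n, (if f z.1 ≠ f (mix S z.1 z.2) then (1 : ℝ) else 0) ≤
      2 ^ n * (2 ^ n * ∑ i ∈ S, influence f i) := by
  induction S using Finset.induction_on with
  | empty =>
    have h : ∀ x y : Cube n, mix ∅ x y = x := fun x y => by ext i; simp [mix]
    simp [h]
  | insert i S hi ih =>
    have hinv : Function.Involutive fun z : Cube n × Cube n => (mix S z.1 z.2, mix S z.2 z.1) := by
      rintro ⟨x, y⟩
      ext j <;> by_cases hj : j ∈ S <;> simp [mix, hj]
    have hmix : ∀ z : Cube n × Cube n, mix (insert i S) z.1 z.2 =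
        Function.update (mix S z.1 z.2) i (mix S z.2 z.1 i) := by
      rintro ⟨x, y⟩
      ext j
      rcases eq_or_ne j i with rfl | hji
      · simp [mix, hi]
      · simp [mix, hji]
    have h1 : ∑ z : Cube n × Cube n,
        (if f (mix S z.1 z.2) ≠ f (mix (insert i S) z.1 z.2) then (1 : ℝ) else 0) ≤
        2 ^ n * (2 ^ n * influence f i) := by
      simp_rw [hmix]
      refine (Equiv.sum_comp hinv.toPerm fun z : Cube n × Cube n =>
        if f z.1 ≠ f (Function.update z.1 i (z.2 i)) then (1 : ℝ) else 0).le.trans ?_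
      rw [Fintype.sum_prod_type_right]
      have h2 : ∀ y : Cube n,
          ∑ x, (if f x ≠ f (Function.update x i (y i)) then (1 : ℝ) else 0) ≤
          2 ^ n * influence f i := by
        intro y
        rw [influence, prob_eq_sum, mul_div_cancel₀ _ (by positivity)]
        refine Finset.sum_le_sum fun x _ => ?_
        by_cases hx : f x ≠ f (Function.update x i (y i))
        · rw [if_pos hx, if_pos]
          rcases eq_or_ne (y i) (x i) with h | h
          · exact absurd (by rw [h, Function.update_eq_self]) hx
          · rwa [flipAt, ← Bool.eq_not.2 h]
        · rw [if_neg hx]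
          split_ifs <;> norm_num
      refine (Finset.sum_le_sum fun y _ => h2 y).trans (le_of_eq ?_)
      simp
    have h3 : ∀ z : Cube n × Cube n,
        (if f z.1 ≠ f (mix (insert i S) z.1 z.2) then (1 : ℝ) else 0) ≤
        (if f z.1 ≠ f (mix S z.1 z.2) then (1 : ℝ) else 0) +
          if f (mix S z.1 z.2) ≠ f (mix (insert i S) z.1 z.2) then (1 : ℝ) else 0 := by
      intro z
      by_cases ha : f z.1 = f (mix S z.1 z.2)
      · simp [ha]
      · rw [if_pos (show f z.1 ≠ f (mix S z.1 z.2) from ha)]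
        split_ifs <;> norm_num
    refine (Finset.sum_le_sum fun z _ => h3 z).trans ?_
    rw [Finset.sum_add_distrib, Finset.sum_insert hi, mul_add, mul_add]
    linarith

theorem exists_prob_ne_mix_le (f : Cube n → Bool) (S : Finset (Fin n)) :
    ∃ y, prob (fun x => f x ≠ f (mix S x y)) ≤ ∑ i ∈ S, influence f i := by
  classical
  have h := sum_ne_mix_le f S
  rw [Fintype.sum_prod_type_right] at h
  obtain ⟨y, -, hy⟩ := Finset.exists_le_of_sum_le (s := Finset.univ) (Finset.univ_nonempty)
    (f := fun y => ∑ x, if f x ≠ f (mix S x y) then (1 : ℝ) else 0)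
    (g := fun _ : Cube n => 2 ^ n * ∑ i ∈ S, influence f i) (by simpa using h)
  refine ⟨y, ?_⟩
  rw [prob_eq_sum, div_le_iff₀ (by positivity)]
  linarith

end Influence

/-! ## Approximation of monotone DNF expressions -/

section DNF
variable {n : ℕ}

/-- The function computed by a monotone DNF expression. -/
def evalDNF (D : Finset (Finset (Fin n))) (x : Cube n) : Bool :=
  decide (∃ T ∈ D, ∀ i ∈ T, x i = true)

theorem evalDNF_eq_true {D : Finset (Finset (Fin n))} {x : Cube n} :
    evalDNF D x = true ↔ ∃ T ∈ D, ∀ i ∈ T, x i = true := by simp [evalDNF]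

theorem evalDNF_mono {D E : Finset (Finset (Fin n))} (h : D ⊆ E) {x : Cube n}
    (hx : evalDNF D x = true) : evalDNF E x = true := by
  rw [evalDNF_eq_true] at *
  obtain ⟨T, hT, hx⟩ := hx
  exact ⟨T, h hT, hx⟩

theorem prob_evalDNF_filter_le (D : Finset (Finset (Fin n))) (w : ℕ) :
    prob (fun x => evalDNF D x ≠ evalDNF (D.filter fun T => T.card ≤ w) x) ≤
      D.card * (1 / 2) ^ w := by
  have h1 : prob (fun x => evalDNF D x ≠ evalDNF (D.filter fun T => T.card ≤ w) x) ≤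
      prob fun x => ∃ T ∈ D.filter fun T => ¬ T.card ≤ w, ∀ i ∈ T, x i = true := by
    refine prob_mono fun x hx => ?_
    have hD : evalDNF D x = true := by
      by_contra h
      refine hx ?_
      rw [Bool.not_eq_true] at h
      rw [h, eq_comm, ← Bool.not_eq_true]
      exact fun h' => by simp [evalDNF_mono (Finset.filter_subset _ _) h'] at h
    obtain ⟨T, hT, hTx⟩ := evalDNF_eq_true.1 hD
    refine ⟨T, Finset.mem_filter.2 ⟨hT, fun hw => hx ?_⟩, hTx⟩
    rw [hD, eq_comm, evalDNF_eq_true]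
    exact ⟨T, Finset.mem_filter.2 ⟨hT, hw⟩, hTx⟩
  refine h1.trans ((prob_exists_le _ _).trans ?_)
  refine (Finset.sum_le_card_nsmul _ _ ((1 / 2) ^ w) fun T hT => ?_).trans ?_
  · rw [prob_forall_mem]
    exact pow_le_pow_of_le_one (by norm_num) (by norm_num)
      (le_of_lt (not_le.1 (Finset.mem_filter.1 hT).2))
  · rw [nsmul_eq_mul]
    gcongr
    exact Finset.filter_subset _ _

theorem influence_evalDNF_eq_zero {D : Finset (Finset (Fin n))} {i : Fin n}
    (hi : ∀ T ∈ D, i ∉ T) : influence (evalDNF D) i = 0 := by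
  have h : ∀ x, evalDNF D x = evalDNF D (flipAt i x) := fun x => by
    unfold evalDNF
    congr 1
    refine propext (exists_congr fun T => and_congr_right fun hT => forall₂_congr fun j hj => ?_)
    rw [flipAt, Function.update_of_ne (fun h => hi T hT (by rwa [← h]))]
  simp [influence, ← h, prob]

/-- The variables in the terms of bounded width. -/
def narrowVars (D : Finset (Finset (Fin n))) (w : ℕ) : Finset (Fin n) :=
  (D.filter fun T => T.card ≤ w).biUnion id

theorem card_narrowVars_le (D : Finset (Finset (Fin n))) (w : ℕ) :
    (narrowVars D w).card ≤ D.card * w :=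
  (Finset.card_biUnion_le_card_mul _ _ _ fun _ hT => (Finset.mem_filter.1 hT).2).trans
    (Nat.mul_le_mul_right _ (Finset.card_filter_le _ _))

theorem influence_le_of_notMem_narrowVars (D : Finset (Finset (Fin n))) (w : ℕ) {i : Fin n}
    (hi : i ∉ narrowVars D w) : influence (evalDNF D) i ≤ 2 * (D.card * (1 / 2) ^ w) := by
  have h1 := influence_le (evalDNF (D.filter fun T => T.card ≤ w)) (evalDNF D) i
  rw [influence_evalDNF_eq_zero fun T hT hiT => hi (Finset.mem_biUnion.2 ⟨T, hT, hiT⟩)] at h1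
  have h2 := prob_evalDNF_filter_le D w
  simp_rw [ne_comm (a := evalDNF D _)] at h2
  linarith

/-- The error of a disjunction of approximate implicants over the influential variables. -/
theorem prob_ne_evalDNF_le (D : Finset (Finset (Fin n))) (R : Finset (Fin n))
    (K : Finset (Finset (Fin n))) (w w' : ℕ) {θ δ ε : ℝ}
    (hR : ∀ i, i ∉ R → influence (evalDNF D) i ≤ θ)
    (hδ : ((narrowVars D w').card : ℝ) * (θ + 2 * (D.card * (1 / 2) ^ w')) ≤ δ) (hθ : 0 ≤ θ)
    (hK : ∀ T ∈ K, prob (fun x => evalDNF D x = false ∧ ∀ i ∈ T, x i = true) ≤ ε)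
    (hK' : ∀ T, T ⊆ R → T.card ≤ w →
      prob (fun x => evalDNF D x = false ∧ ∀ i ∈ T, x i = true) ≤ δ → T ∈ K) :
    prob (fun x => evalDNF D x ≠ evalDNF K x) ≤
      K.card * ε + (D.card * (1 / 2) ^ w' + (δ + D.card * (1 / 2) ^ w)) := by
  set D₂ := D.filter fun T => T.card ≤ w' with hD₂
  set V := narrowVars D w' with hV
  have h1 := prob_evalDNF_filter_le D w'
  obtain ⟨y, hy⟩ := exists_prob_ne_mix_le (evalDNF D₂) (V \ R)
  have h2 : prob (fun x => evalDNF D₂ x ≠ evalDNF D₂ (mix (V \ R) x y)) ≤ δ := by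
    refine hy.trans (le_trans ?_ hδ)
    refine (Finset.sum_le_card_nsmul _ _ (θ + 2 * (D.card * (1 / 2) ^ w')) fun i hi => ?_).trans ?_
    · have := influence_le (evalDNF D) (evalDNF D₂) i
      have := hR i (Finset.mem_sdiff.1 hi).2
      linarith
    · rw [nsmul_eq_mul]
      gcongr
      exact Finset.sdiff_subset
  set D₃ := (D₂.filter fun T => ∀ i ∈ T, i ∉ R → y i = true).image (· ∩ R) with hD₃
  have h3 : ∀ x, evalDNF D₂ (mix (V \ R) x y) = evalDNF D₃ x := by
    intro x
    rw [Bool.eq_iff_iff, evalDNF_eq_true, evalDNF_eq_true]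
    have hmV : ∀ T ∈ D₂, ∀ i ∈ T, i ∈ V := fun T hT i hi => Finset.mem_biUnion.2 ⟨T, hT, hi⟩
    constructor
    · rintro ⟨T, hT, hx⟩
      refine ⟨T ∩ R, Finset.mem_image.2 ⟨T, Finset.mem_filter.2 ⟨hT, fun i hi hiR => ?_⟩, rfl⟩,
        fun i hi => ?_⟩
      · have := hx i hi
        rwa [mix, if_pos (Finset.mem_sdiff.2 ⟨hmV T hT i hi, hiR⟩)] at this
      · rw [Finset.mem_inter] at hi
        have := hx i hi.1
        rwa [mix, if_neg (fun h => (Finset.mem_sdiff.1 h).2 hi.2)] at this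
    · rintro ⟨T', hT', hx⟩
      obtain ⟨T, hT, rfl⟩ := Finset.mem_image.1 hT'
      obtain ⟨hT, hyT⟩ := Finset.mem_filter.1 hT
      refine ⟨T, hT, fun i hi => ?_⟩
      by_cases hiR : i ∈ R
      · rw [mix, if_neg (fun h => (Finset.mem_sdiff.1 h).2 hiR)]
        exact hx i (Finset.mem_inter.2 ⟨hi, hiR⟩)
      · rw [mix, if_pos (Finset.mem_sdiff.2 ⟨hmV T hT i hi, hiR⟩)]
        exact hyT i hi hiR
  simp_rw [h3] at h2
  have hc : (D₃.card : ℝ) ≤ D.card := by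
    exact_mod_cast Finset.card_image_le.trans
      ((Finset.card_filter_le _ _).trans (Finset.card_filter_le _ _))
  have h4 : prob (fun x => evalDNF D₃ x ≠ evalDNF (D₃.filter fun T => T.card ≤ w) x) ≤
      D.card * (1 / 2) ^ w :=
    (prob_evalDNF_filter_le D₃ w).trans (by gcongr)
  have h5 : ∀ x, evalDNF (D₃.filter fun T => T.card ≤ w) x = true → evalDNF K x = true := by
    refine fun x hx => evalDNF_mono (fun T hT => ?_) hx
    obtain ⟨hT, hTw⟩ := Finset.mem_filter.1 hT
    refine hK' T ?_ hTw (le_trans (prob_mono fun x hx => ?_) h2)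
    · obtain ⟨T', -, rfl⟩ := Finset.mem_image.1 hT
      exact Finset.inter_subset_right
    · have h6 : evalDNF D₃ x = true := evalDNF_eq_true.2 ⟨T, hT, hx.2⟩
      rw [h6]
      intro h7
      have := evalDNF_mono (Finset.filter_subset _ _) h7
      rw [hx.1] at this
      exact Bool.noConfusion this
  have h6 : prob (fun x => ∃ T ∈ K, evalDNF D x = false ∧ ∀ i ∈ T, x i = true) ≤ K.card * ε := by
    refine (prob_exists_le K _).trans ((Finset.sum_le_card_nsmul _ _ ε hK).trans ?_)
    rw [nsmul_eq_mul]
  have h7 := prob_or_le (fun x => evalDNF D₂ x ≠ evalDNF D₃ x)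
    fun x => evalDNF D₃ x ≠ evalDNF (D₃.filter fun T => T.card ≤ w) x
  have h8 := prob_or_le (fun x => evalDNF D x ≠ evalDNF D₂ x) fun x =>
    evalDNF D₂ x ≠ evalDNF D₃ x ∨ evalDNF D₃ x ≠ evalDNF (D₃.filter fun T => T.card ≤ w) x
  have h9 := prob_or_le (fun x => ∃ T ∈ K, evalDNF D x = false ∧ ∀ i ∈ T, x i = true) fun x =>
    evalDNF D x ≠ evalDNF D₂ x ∨
    evalDNF D₂ x ≠ evalDNF D₃ x ∨ evalDNF D₃ x ≠ evalDNF (D₃.filter fun T => T.card ≤ w) x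
  refine le_trans (prob_mono fun x hx => ?_) (h9.trans (by linarith))
  by_contra! hcon
  obtain ⟨c1, c2, c3, c4⟩ := hcon
  rw [← c3, ← c2] at c4
  cases hD : evalDNF D x
  · rw [hD] at hx
    have hKx : evalDNF K x = true := by
      cases h : evalDNF K x
      · exact absurd h.symm hx
      · rfl
    obtain ⟨T, hT, hTx⟩ := evalDNF_eq_true.1 hKx
    obtain ⟨i, hi, hxi⟩ := c1 T hT hD
    exact hxi (hTx i hi)
  · exact hx (hD.trans (h5 x (by rw [← c4, hD])).symm)

end DNF

/-! ## Deviation bounds for counts of examples -/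

section Deviation
variable {n : ℕ}

instance : IsProbabilityMeasure (sourceLaw n) := by unfold sourceLaw; infer_instance

theorem sourceLaw_real_fst (A : Set (ℕ → Cube n)) (hA : MeasurableSet A) :
    (sourceLaw n).real {ω | ω.1 ∈ A} = (Measure.infinitePi fun _ : ℕ => uniform n).real A := by
  rw [measureReal_def, measureReal_def]
  congr 1
  exact measurePreserving_fst.measure_preimage hA.nullMeasurableSet

open ProbabilityTheory in
theorem infinitePi_count_ge_le (p : Cube n → Prop) [DecidablePred p] (a m : ℕ) {u : ℝ}
    (hu : 0 ≤ u) : (Measure.infinitePi fun _ : ℕ => uniform n).real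
      {ω | m * prob p + u ≤ Nat.count (fun j => p (ω (a + j))) m} ≤
      Real.exp (-u ^ 2 / (2 * m * (1 / 4))) := by
  set P := Measure.infinitePi fun _ : ℕ => uniform n with hP
  set g : Cube n → ℝ := fun x => if p x then 1 else 0 with hg
  have hgm : Measurable g := measurable_of_finite g
  have hint : ∀ j : ℕ, ∫ ω, g (ω j) ∂P = prob p := by
    intro j
    have h1 : ∫ ω, g (ω j) ∂P = ∫ x, g x ∂(uniform n) := by
      rw [← Measure.infinitePi_map_eval (fun _ : ℕ => uniform n) j,
        integral_map (measurable_pi_apply j).aemeasurable hgm.aestronglyMeasurable]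
    rw [h1]
    have h2 : g = Set.indicator {x | p x} 1 := by
      ext x; simp [g, Set.indicator_apply]
    rw [h2, integral_indicator_one (Set.toFinite _).measurableSet, prob]
  have hind : iIndepFun (fun (j : ℕ) (ω : ℕ → Cube n) => g (ω (a + j)) - prob p) P := by
    have h := iIndepFun_infinitePi (P := fun _ : ℕ => uniform n)
      (X := fun _ x => g x - prob p) (fun _ => measurable_of_finite _)
    exact h.precomp (g := fun j : ℕ => a + j) (add_right_injective a)
  have hsub : ∀ j < m, HasSubgaussianMGF (fun ω : ℕ → Cube n => g (ω (a + j)) - prob p)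
      ((‖(1 : ℝ) - 0‖₊ / 2) ^ 2) P := by
    intro j _
    have hm : Measurable fun ω : ℕ → Cube n => g (ω (a + j)) :=
      hgm.comp (measurable_pi_apply (a + j))
    have h := hasSubgaussianMGF_of_mem_Icc (μ := P) (X := fun ω : ℕ → Cube n => g (ω (a + j)))
      (a := 0) (b := 1) hm.aemeasurable
      (Filter.Eventually.of_forall fun ω => by
        simp only [g]; split_ifs <;> simp)
    rwa [hint] at h
  have h := HasSubgaussianMGF.measure_sum_range_ge_le_of_iIndepFun hind hsub hu
  refine le_trans (le_of_eq ?_) (h.trans (le_of_eq ?_))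
  · congr 1
    ext ω
    have : ∑ j ∈ Finset.range m, (g (ω (a + j)) - prob p) =
        Nat.count (fun j => p (ω (a + j))) m - m * prob p := by
      rw [Finset.sum_sub_distrib, Nat.count_eq_card_filter_range]
      simp [g]
    simp only [Set.mem_ofPred_eq, this]
    constructor <;> intro h <;> linarith
  · congr 2
    simp
    norm_num

theorem sourceLaw_count_ge_le (p : Cube n → Prop) [DecidablePred p] (a m : ℕ) {u : ℝ}
    (hu : 0 ≤ u) : (sourceLaw n).real
      {ω | m * prob p + u ≤ Nat.count (fun j => p (ω.1 (a + j))) m} ≤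
      Real.exp (-u ^ 2 / (2 * m * (1 / 4))) := by
  refine le_trans (le_of_eq ?_) (infinitePi_count_ge_le p a m hu)
  refine sourceLaw_real_fst {ω | m * prob p + u ≤ Nat.count (fun j => p (ω (a + j))) m} ?_
  have h : ∀ ω : ℕ → Cube n, (Nat.count (fun j => p (ω (a + j))) m : ℝ) =
      ∑ j ∈ Finset.range m, if p (ω (a + j)) then (1 : ℝ) else 0 := by
    intro ω
    rw [Nat.count_eq_card_filter_range]; simp
  simp_rw [h]
  refine measurableSet_le measurable_const (Finset.measurable_sum _ fun j _ => ?_)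
  exact (measurable_of_finite fun x : Cube n => if p x then (1 : ℝ) else 0).comp
    (measurable_pi_apply (a + j))

theorem prob_not (p : Cube n → Prop) : prob (fun x => ¬ p x) = 1 - prob p :=
  probReal_compl_eq_one_sub (Set.toFinite _).measurableSet

theorem sourceLaw_count_le_le (p : Cube n → Prop) [DecidablePred p] (a m : ℕ) {u : ℝ}
    (hu : 0 ≤ u) : (sourceLaw n).real
      {ω | Nat.count (fun j => p (ω.1 (a + j))) m ≤ m * prob p - u} ≤
      Real.exp (-u ^ 2 / (2 * m * (1 / 4))) := by
  refine le_trans (le_of_eq ?_) (sourceLaw_count_ge_le (fun x => ¬ p x) a m hu)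
  congr 1
  ext ω
  have h : (Nat.count (fun j => ¬ p (ω.1 (a + j))) m : ℝ) =
      m - Nat.count (fun j => p (ω.1 (a + j))) m := by
    rw [Nat.count_eq_card_filter_range, Nat.count_eq_card_filter_range, eq_sub_iff_add_eq,
      ← Nat.cast_add, add_comm, Finset.card_filter_add_card_filter_not, Finset.card_range]
  simp only [Set.mem_ofPred_eq, h, prob_not]
  constructor <;> intro h <;> linarith

/-- If each of finitely many events of which one is to be avoided has small probability, then with
probability at least one half none of them occurs. -/
theorem half_le_of_sum_le {ι : Type*} [Fintype ι] (B : ι → Set (Source n)) {q : ℝ}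
    (hB : ∀ i, (sourceLaw n).real (B i) ≤ q) (hq : Fintype.card ι * q ≤ 1 / 2)
    {G : Set (Source n)} (hG : ∀ ω, (∀ i, ω ∉ B i) → ω ∈ G) : 1 / 2 ≤ sourceLaw n G := by
  have h1 : (sourceLaw n).real (⋃ i, B i) ≤ 1 / 2 := by
    refine (measureReal_iUnion_fintype_le _).trans
      ((Finset.sum_le_card_nsmul _ _ q fun i _ => hB i).trans ?_)
    rwa [nsmul_eq_mul]
  have h2 : (1 : ℝ) ≤ (sourceLaw n).real (⋃ i, B i) + (sourceLaw n).real G := by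
    rw [← probReal_univ (μ := sourceLaw n)]
    refine (measureReal_mono (fun ω _ => ?_)).trans (measureReal_union_le _ _)
    by_cases h : ∃ i, ω ∈ B i
    · exact .inl (Set.mem_iUnion.2 h)
    · exact .inr (hG ω (not_exists.1 h))
  have h3 : (1 / 2 : ℝ) ≤ (sourceLaw n).real G := by linarith
  rw [measureReal_def, ← ENNReal.ofReal_le_iff_le_toReal (measure_ne_top _ _)] at h3
  convert h3
  rw [ENNReal.ofReal_div_of_pos (by norm_num)]
  simp

end Deviation

/-! ## The examples are typical with probability at least one half -/

section Typical
variable {n : ℕ}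

/-- The set of variables listed by a function. -/
def listedVars {w : ℕ} (φ : Fin w → Option (Fin n)) : Finset (Fin n) :=
  Finset.univ.filter fun i => ∃ d, φ d = some i

theorem mem_listedVars {w : ℕ} {φ : Fin w → Option (Fin n)} {i : Fin n} :
    i ∈ listedVars φ ↔ ∃ d, φ d = some i := by simp [listedVars]

/-- A negative point that satisfies the conjunction of the variables in `T`. -/
def Violates (f : Cube n → Bool) (T : Finset (Fin n)) (x : Cube n) : Prop :=
  f x = false ∧ ∀ i ∈ T, x i = true

instance (f : Cube n → Bool) (T : Finset (Fin n)) : DecidablePred (Violates f T) := fun x => by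
  unfold Violates; infer_instance

/-- All counts fall on the side of their thresholds that their means suggest. -/
structure Typical (s k : ℕ) (f : Cube n → Bool) (ω : Source n) : Prop where
  agree_gt : ∀ i : Fin n, 1 / (resolution s k : ℝ) < influence f i →
    (params n s k).agreeThreshold < agreeCount ⟨f, ω.1, ω.2⟩ (params n s k).samples i
  agree_le : ∀ i : Fin n, influence f i ≤ 1 / (2 * resolution s k : ℝ) →
    agreeCount ⟨f, ω.1, ω.2⟩ (params n s k).samples i ≤ (params n s k).agreeThreshold
  bad_le : ∀ φ : Fin (termWidth s k) → Option (Fin n),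
    prob (Violates f (listedVars φ)) ≤ 2 * (termBase s k - 1 : ℕ) / (resolution s k : ℝ) →
    Nat.count (fun j => Violates f (listedVars φ) (ω.1 ((params n s k).samples + j)))
      (params n s k).samples ≤ (params n s k).badThreshold
  bad_gt : ∀ φ : Fin (termWidth s k) → Option (Fin n),
    (2 * (termBase s k - 1 : ℕ) + 1 / 4) / (resolution s k : ℝ) <
      prob (Violates f (listedVars φ)) →
    (params n s k).badThreshold <
      Nat.count (fun j => Violates f (listedVars φ) (ω.1 ((params n s k).samples + j)))
        (params n s k).samples

theorem exp_deviation_le {s k : ℕ} (hs : 1 ≤ s) (hk : 1 ≤ k) :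
    Real.exp (-(deviation n s k : ℝ) ^ 2 / (2 * (params n s k).samples * (1 / 4))) ≤
      (1 / 2) ^ (Nat.clog 2 (n + 1) * (termWidth s k + 1) + 1) := by
  set g := Nat.clog 2 (n + 1) * (termWidth s k + 1) + 1 with hg
  have hE : 0 < (resolution s k : ℝ) := by
    have := (resolution_ge hs hk).2.1
    have := one_le_termCount s k
    exact_mod_cast (by omega : 0 < resolution s k)
  have hu : (deviation n s k : ℝ) = 4 * resolution s k * g := by
    simp only [deviation, hg]; push_cast; ring
  have hg0 : (0 : ℝ) < g := by rw [hg]; positivity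
  have h1 : -(deviation n s k : ℝ) ^ 2 / (2 * (params n s k).samples * (1 / 4)) = g * (-1) := by
    simp only [params]
    push_cast
    rw [hu]
    field_simp
    norm_num
  rw [h1, Real.exp_nat_mul]
  refine pow_le_pow_left₀ (Real.exp_pos _).le ?_ _
  rw [Real.exp_neg, one_div]
  refine inv_anti₀ (by norm_num) ?_
  have := Real.add_one_le_exp (1 : ℝ)
  linarith

theorem card_events_mul_le {s k : ℕ} :
    (Fintype.card (Fin n ⊕ (Fin (termWidth s k) → Option (Fin n))) : ℝ) *
      (1 / 2) ^ (Nat.clog 2 (n + 1) * (termWidth s k + 1) + 1) ≤ 1 / 2 := by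
  set w := termWidth s k
  have h1 : n + (n + 1) ^ w ≤ 2 ^ (Nat.clog 2 (n + 1) * (w + 1)) := by
    have h2 := Nat.pow_le_pow_left (Nat.le_pow_clog (b := 2) (by norm_num) (n + 1)) (w + 1)
    rw [← pow_mul] at h2
    refine le_trans ?_ h2
    have h3 : 1 ≤ (n + 1) ^ w := Nat.one_le_pow _ _ (Nat.succ_pos n)
    rw [pow_succ]
    nlinarith
  have h4 : ((n + (n + 1) ^ w : ℕ) : ℝ) ≤ 2 ^ (Nat.clog 2 (n + 1) * (w + 1)) := by
    exact_mod_cast h1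
  simp only [Fintype.card_sum, Fintype.card_fun, Fintype.card_option, Fintype.card_fin]
  rw [pow_succ, ← mul_assoc]
  refine mul_le_of_le_one_left (by norm_num) ?_
  rw [one_div, inv_pow]
  exact mul_inv_le_one_of_le₀ h4 (by positivity)

theorem half_le_typical {s k : ℕ} (hs : 1 ≤ s) (hk : 1 ≤ k) {f : Cube n → Bool}
    (hf : ∀ x y : Cube n, (∀ i, x i = true → y i = true) → f x = true → f y = true) :
    1 / 2 ≤ sourceLaw n {ω | Typical s k f ω} := by
  obtain ⟨u, hu⟩ : ∃ u : ℝ, u = deviation n s k := ⟨_, rfl⟩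
  obtain ⟨E, hE⟩ : ∃ E : ℝ, E = resolution s k := ⟨_, rfl⟩
  obtain ⟨m, hm⟩ : ∃ m : ℕ, m = (params n s k).samples := ⟨_, rfl⟩
  have hu0 : 0 ≤ u := by rw [hu]; positivity
  have hE0 : 0 < E := by
    rw [hE]
    have := (resolution_ge hs hk).2.1
    have := one_le_termCount s k
    exact_mod_cast (by omega : 0 < resolution s k)
  have hmE : (m : ℝ) = 8 * E * u := by rw [hm, hE, hu]; simp [params]
  have ht1 : ((params n s k).agreeThreshold : ℝ) = 4 * E * u + 3 * u := by
    rw [hE, hu]; simp [params]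
  have ht2 : ((params n s k).badThreshold : ℝ) = 16 * ((termBase s k - 1 : ℕ) * u) + u := by
    rw [hu]; simp [params]
  have hq := exp_deviation_le (n := n) hs hk
  rw [← hu, ← hm] at hq
  let B : Fin n ⊕ (Fin (termWidth s k) → Option (Fin n)) → Set (Source n) := fun e => match e with
    | .inl i => if 1 / E < influence f i then
        {ω | Nat.count (fun j => ω.1 (0 + j) i = f (ω.1 (0 + j))) m ≤
          m * prob (fun x => x i = f x) - u}
      else {ω | m * prob (fun x => x i = f x) + u ≤
          Nat.count (fun j => ω.1 (0 + j) i = f (ω.1 (0 + j))) m}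
    | .inr φ => if 2 * (termBase s k - 1 : ℕ) / E < prob (Violates f (listedVars φ)) then
        {ω | Nat.count (fun j => Violates f (listedVars φ) (ω.1 (m + j))) m ≤
          m * prob (Violates f (listedVars φ)) - u}
      else {ω | m * prob (Violates f (listedVars φ)) + u ≤
          Nat.count (fun j => Violates f (listedVars φ) (ω.1 (m + j))) m}
  refine half_le_of_sum_le B (fun e => le_trans ?_ hq) card_events_mul_le fun ω hω => ?_
  · rcases e with i | φ
    · simp only [B]
      split_ifs
      · exact sourceLaw_count_le_le (fun x => x i = f x) 0 m hu0
      · exact sourceLaw_count_ge_le (fun x => x i = f x) 0 m hu0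
    · simp only [B]
      split_ifs
      · exact sourceLaw_count_le_le (Violates f (listedVars φ)) m m hu0
      · exact sourceLaw_count_ge_le (Violates f (listedVars φ)) m m hu0
  · have hag : ∀ i : Fin n, agreeCount ⟨f, ω.1, ω.2⟩ m i =
        Nat.count (fun j => ω.1 (0 + j) i = f (ω.1 (0 + j))) m := fun i => by
      simp only [agreeCount, lookup_val, zero_add]
    have hp : ∀ i, (m : ℝ) * prob (fun x => x i = f x) = 4 * E * u + 4 * E * u * influence f i :=
      fun i => by rw [prob_eq_apply hf, hmE]; ring
    have hE2 : 1 / (2 * E) < 1 / E := one_div_lt_one_div_of_lt hE0 (by linarith)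
    refine ⟨fun i hi => ?_, fun i hi => ?_, fun φ hφ => ?_, fun φ hφ => ?_⟩
    · rw [← hE] at hi
      have h := hω (.inl i)
      simp only [B, if_pos hi, Set.mem_ofPred_eq, not_le, hp] at h
      rw [← hm, hag, ← Nat.cast_lt (α := ℝ), ht1]
      rw [div_lt_iff₀ hE0] at hi
      nlinarith
    · rw [← hE] at hi
      have h := hω (.inl i)
      simp only [B, if_neg (not_lt.2 (hi.trans hE2.le)), Set.mem_ofPred_eq, not_le, hp] at h
      rw [← hm, hag, ← Nat.cast_le (α := ℝ), ht1]
      rw [le_div_iff₀ (by linarith)] at hi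
      nlinarith
    · rw [← hE] at hφ
      have h := hω (.inr φ)
      simp only [B, if_neg (not_lt.2 hφ), Set.mem_ofPred_eq, not_le, hmE] at h
      rw [← hm, ← Nat.cast_le (α := ℝ), ht2]
      rw [le_div_iff₀ hE0] at hφ
      nlinarith
    · rw [← hE] at hφ
      have h := hω (.inr φ)
      have h' : 2 * (termBase s k - 1 : ℕ) / E < prob (Violates f (listedVars φ)) :=
        lt_of_le_of_lt (by gcongr; linarith) hφ
      simp only [B, if_pos h', Set.mem_ofPred_eq, not_le, hmE] at h
      rw [← hm, ← Nat.cast_lt (α := ℝ), ht2]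
      rw [div_lt_iff₀ hE0] at hφ
      nlinarith

end Typical

/-! ## The hypothesis is accurate on typical examples -/

section Accuracy
variable {n s k : ℕ}

theorem pow_le_two_pow_width (hs : 1 ≤ s) (hk : 1 ≤ k) :
    4 * s * resolution s k ≤ 2 ^ (16 * (s * termWidth s k ^ 2)) := by
  have hw := two_le_termWidth hs hk
  have h4 : 4 * (s * k) ≤ 2 ^ termWidth s k := Nat.le_pow_clog (by norm_num) _
  unfold resolution termCount
  have hB : termBase s k = 16 * ((s * termWidth s k) * (s * termWidth s k)) + 1 := rfl
  set w := termWidth s k with hwdef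
  set B := termBase s k
  obtain ⟨v, hv⟩ : ∃ v, v = s * w := ⟨_, rfl⟩
  have hvw : w ≤ v := hv ▸ Nat.le_mul_of_pos_left w hs
  rw [← hv] at hB
  have h5 : 16 * B ≤ 2 ^ (9 + 2 * v) := by
    have h6 : v ≤ 2 ^ v := Nat.lt_two_pow_self.le
    have h7 : v * v ≤ 2 ^ (2 * v) := by
      rw [two_mul, pow_add]; exact Nat.mul_le_mul h6 h6
    have h8 : 1 ≤ v * v := Nat.mul_pos (by omega) (by omega)
    rw [pow_add, hB]
    norm_num
    omega
  have h9 : 32 ≤ 8 ^ w := le_trans (by norm_num) (Nat.pow_le_pow_right (n := 8) (by norm_num) hw)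
  calc 4 * s * (32 * (k * (B ^ w * (B - 1))))
      = 32 * (4 * (s * k)) * (B ^ w * (B - 1)) := by ring
    _ ≤ 8 ^ w * 2 ^ w * (B ^ w * (16 * B)) := by gcongr; omega
    _ = (16 * B) ^ (w + 1) := by rw [pow_succ, mul_pow, ← mul_pow]; norm_num; ring
    _ ≤ (2 ^ (9 + 2 * v)) ^ (w + 1) := Nat.pow_le_pow_left h5 _
    _ = 2 ^ ((9 + 2 * v) * (w + 1)) := by rw [pow_mul]
    _ ≤ 2 ^ (16 * (s * w ^ 2)) := by
        refine Nat.pow_le_pow_right (by norm_num) ?_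
        have : s * w ^ 2 = v * w := by rw [hv]; ring
        rw [this]
        nlinarith

/-- The variables of the conjunction with number `t`, in the form of a list. -/
def Params.listing (P : Params) (n : ℕ) (R : ℕ → ℕ) (t : ℕ) (d : Fin P.width) :
    Option (Fin n) :=
  if h : R (t / P.base ^ (d : ℕ) % P.base) < n then some ⟨_, h⟩ else none

theorem sat_iff (P : Params) (R : ℕ → ℕ) (t : ℕ) (x : Cube n) :
    P.Sat R t x ↔ ∀ i ∈ listedVars (P.listing n R t), x i = true := by
  simp only [Params.Sat, mem_listedVars, forall_exists_index, Params.listing]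
  constructor
  · rintro h i d hd
    split_ifs at hd with hlt
    have := h d d.2
    rw [lookup, dif_pos hlt] at this
    rwa [← Option.some.inj hd]
  · intro h d hd
    rw [lookup]
    split_ifs with hlt
    · exact h _ ⟨d, hd⟩ (dif_pos hlt)
    · rfl

theorem exists_listing_eq {R : ℕ → ℕ} {p : ℕ → Prop} [DecidablePred p]
    (hR : Selects n (termBase s k) p R) (hc : Nat.count p n ≤ termBase s k - 1)
    (T : Finset (Fin n)) (hT : ∀ i ∈ T, p i) (hw : T.card ≤ termWidth s k) :
    ∃ t < termCount s k, listedVars ((params n s k).listing n R t) = T := by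
  have hB : 0 < termBase s k := Nat.succ_pos _
  choose! j hj hRj using hR.complete hc
  let ψ : Fin (termWidth s k) → Fin (termBase s k) := fun d =>
    if h : (d : ℕ) < T.card then
      ⟨j (T.equivFin.symm ⟨d, h⟩ : Fin n), lt_of_lt_of_le
        (hj _ (Fin.is_lt _) (hT _ (T.equivFin.symm ⟨d, h⟩).2)) (Nat.sub_le _ _)⟩
    else ⟨termBase s k - 1, Nat.sub_lt hB one_pos⟩
  have hdig : ∀ d : Fin (termWidth s k), ((finFunctionFinEquiv ψ : Fin _) : ℕ) /
      termBase s k ^ (d : ℕ) % termBase s k = ψ d := fun d => by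
    conv_rhs => rw [← finFunctionFinEquiv.symm_apply_apply ψ]
    rfl
  refine ⟨finFunctionFinEquiv ψ, (finFunctionFinEquiv ψ).2, ?_⟩
  ext i
  rw [mem_listedVars]
  change (∃ d : Fin (termWidth s k), (if h : R (((finFunctionFinEquiv ψ : Fin _) : ℕ) /
      termBase s k ^ (d : ℕ) % termBase s k) < n then some (⟨_, h⟩ : Fin n) else none) = some i) ↔ _
  constructor
  · rintro ⟨d, hd⟩
    split_ifs at hd with hlt
    have hd' : R (((finFunctionFinEquiv ψ : Fin _) : ℕ) /
      termBase s k ^ (d : ℕ) % termBase s k) = i := congrArg Fin.val (Option.some.inj hd)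
    rw [hdig] at hd' hlt
    simp only [ψ] at hd' hlt
    split_ifs at hd' hlt with h
    · have h' := hRj _ (Fin.is_lt _) (hT _ (T.equivFin.symm ⟨d, h⟩).2)
      rw [h'] at hd'
      rw [← Fin.ext hd']
      exact (T.equivFin.symm ⟨d, h⟩).2
    · simp only [hR.last] at hlt
      omega
  · intro hi
    have hlt := (T.equivFin ⟨i, hi⟩).2
    refine ⟨⟨T.equivFin ⟨i, hi⟩, hlt.trans_le hw⟩, ?_⟩
    have hRi : R (((finFunctionFinEquiv ψ : Fin _) : ℕ) /
        termBase s k ^ (T.equivFin ⟨i, hi⟩ : ℕ) % termBase s k) = i := by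
      rw [hdig ⟨T.equivFin ⟨i, hi⟩, hlt.trans_le hw⟩]
      simp only [ψ, dif_pos hlt, Fin.eta, Equiv.symm_apply_apply]
      exact hRj _ i.2 (hT i hi)
    rw [dif_pos (by rw [hRi]; exact i.2)]
    exact congrArg some (Fin.ext hRi)

theorem isClose_of_typical (hs : 1 ≤ s) (hk : 1 ≤ k) {ε : ℝ} (hε : 1 / (k : ℝ) ≤ ε)
    {f : Cube n → Bool} (hf : IsMonotoneDNF s f) {ω : Source n} (hω : Typical s k f ω)
    {R : ℕ → ℕ} (hR : Selects n (termBase s k) (fun i => (params n s k).agreeThreshold <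
      agreeCount ⟨f, ω.1, ω.2⟩ (params n s k).samples i) R) {h : Cube n → Bool}
    (hh : ∀ x, h x = true ↔ ∃ t < termCount s k,
      badCount ⟨f, ω.1, ω.2⟩ (params n s k) R (params n s k).samples (params n s k).samples t ≤
        (params n s k).badThreshold ∧ (params n s k).Sat R t x) :
    IsClose ε f h := by
  obtain ⟨D, hDs, hfD⟩ := hf
  obtain rfl : f = evalDNF D := by
    ext x; rw [Bool.eq_iff_iff, hfD, evalDNF_eq_true]
  set P := params n s k with hP
  set E : ℝ := (resolution s k : ℝ) with hE
  set r : ℝ := ((termBase s k - 1 : ℕ) : ℝ) with hr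
  set N : ℝ := (termCount s k : ℝ) with hN
  set w := termWidth s k with hw
  set w' := 16 * (s * w ^ 2) with hw'
  have hN1 : 1 ≤ N := by rw [hN]; exact_mod_cast one_le_termCount s k
  have hr1 : 1 ≤ r := by
    have := (le_base_sub_one hs hk).1
    rw [hr]; exact_mod_cast (by omega : 1 ≤ termBase s k - 1)
  have hk1 : (1 : ℝ) ≤ k := by exact_mod_cast hk
  have hEe : E = 32 * (k * (N * r)) := by rw [hE, hN, hr, resolution]; push_cast; ring
  have hkNr : 1 ≤ k * (N * r) := one_le_mul_of_one_le_of_one_le hk1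
    (one_le_mul_of_one_le_of_one_le hN1 hr1)
  have hE0 : 0 < E := by rw [hEe]; linarith
  have hs0 : (0 : ℝ) < s := by exact_mod_cast hs
  have hη : (D.card : ℝ) * (1 / 2) ^ w' ≤ 1 / (4 * E) := by
    have h1 : (4 * s * E : ℝ) ≤ 2 ^ w' := by
      rw [hE]; exact_mod_cast pow_le_two_pow_width hs hk
    have h2 : (D.card : ℝ) ≤ s := by exact_mod_cast hDs
    rw [one_div, inv_pow, le_div_iff₀ (by linarith), mul_right_comm,
      mul_inv_le_iff₀ (by positivity)]
    nlinarith
  have hηw : (D.card : ℝ) * (1 / 2) ^ w ≤ 1 / (4 * k) := by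
    have h1 : (4 * (s * k) : ℝ) ≤ 2 ^ w := by
      exact_mod_cast Nat.le_pow_clog (b := 2) (by norm_num) (4 * (s * k))
    have h2 : (D.card : ℝ) ≤ s := by exact_mod_cast hDs
    rw [one_div, inv_pow, le_div_iff₀ (by linarith), mul_right_comm,
      mul_inv_le_iff₀ (by positivity)]
    nlinarith
  set V := narrowVars D w' with hV
  have hVB : V.card ≤ termBase s k - 1 := by
    refine (card_narrowVars_le D w').trans ((Nat.mul_le_mul_right _ hDs).trans (le_of_eq ?_))
    simp only [hw', hw, termBase]
    rw [Nat.add_sub_cancel]; ring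
  have hVr : (V.card : ℝ) ≤ r := by rw [hr]; exact_mod_cast hVB
  set sel : ℕ → Prop := fun i => P.agreeThreshold <
      agreeCount ⟨evalDNF D, ω.1, ω.2⟩ P.samples i with hsel
  have hselV : ∀ i : Fin n, sel i → i ∈ V := by
    intro i hi
    by_contra hiV
    have h1 := influence_le_of_notMem_narrowVars D w' hiV
    refine absurd (hω.agree_le i (h1.trans ?_)) (not_le.2 hi)
    refine (mul_le_mul_of_nonneg_left hη (by norm_num)).trans (le_of_eq ?_)
    rw [← hE]; field_simp; norm_num
  have hcount : Nat.count sel n ≤ termBase s k - 1 := by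
    rw [Nat.count_eq_card_filter_range]
    rw [← Finset.card_map Fin.valEmbedding] at hVB
    refine (Finset.card_le_card fun i hi => ?_).trans hVB
    obtain ⟨hi, hs⟩ := Finset.mem_filter.1 hi
    exact Finset.mem_map.2 ⟨⟨i, Finset.mem_range.1 hi⟩, hselV _ hs, rfl⟩
  set K : Finset (Finset (Fin n)) := ((Finset.range (termCount s k)).filter fun t =>
    badCount ⟨evalDNF D, ω.1, ω.2⟩ P R P.samples P.samples t ≤ P.badThreshold).image
      fun t => listedVars (P.listing n R t) with hKdef
  have hbad : ∀ t, badCount ⟨evalDNF D, ω.1, ω.2⟩ P R P.samples P.samples t =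
      Nat.count (fun j => Violates (evalDNF D) (listedVars (P.listing n R t))
        (ω.1 (P.samples + j))) P.samples := by
    intro t
    simp only [badCount, Violates, sat_iff]
  have hhK : h = evalDNF K := by
    ext x
    rw [Bool.eq_iff_iff, hh, evalDNF_eq_true]
    constructor
    · rintro ⟨t, ht, hb, hx⟩
      exact ⟨_, Finset.mem_image_of_mem _ (Finset.mem_filter.2 ⟨Finset.mem_range.2 ht, hb⟩),
        (sat_iff P R t x).1 hx⟩
    · rintro ⟨T, hT, hx⟩
      obtain ⟨t, ht, rfl⟩ := Finset.mem_image.1 hT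
      obtain ⟨ht, hb⟩ := Finset.mem_filter.1 ht
      exact ⟨t, Finset.mem_range.1 ht, hb, (sat_iff P R t x).2 hx⟩
  have hKcard : (K.card : ℝ) ≤ N := by
    rw [hN]
    exact_mod_cast Finset.card_image_le.trans ((Finset.card_filter_le _ _).trans
      (Finset.card_range _).le)
  have hmain := prob_ne_evalDNF_le D (Finset.univ.filter fun i : Fin n => sel i) K w w'
    (θ := 1 / E) (δ := 2 * r / E) (ε := (2 * r + 1 / 4) / E) ?_ ?_ (by positivity) ?_ ?_
  · have hkε : prob (fun x => evalDNF D x ≠ h x) ≤ 1 / k := by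
      rw [hhK]
      refine hmain.trans ?_
      have a1 : K.card * ((2 * r + 1 / 4) / E) ≤ 1 / (8 * k) := by
        calc K.card * ((2 * r + 1 / 4) / E) ≤ N * ((4 * r) / E) := by
              gcongr; linarith
          _ = 1 / (8 * k) := by rw [hEe]; field_simp; norm_num
      have a2 : 1 / (4 * E) ≤ 1 / (8 * k) := by
        refine one_div_le_one_div_of_le (by linarith) ?_
        rw [hEe]
        have : (k : ℝ) * 1 ≤ k * (N * r) :=
          mul_le_mul_of_nonneg_left (one_le_mul_of_one_le_of_one_le hN1 hr1) (by linarith)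
        linarith
      have a3 : 2 * r / E ≤ 1 / (8 * k) := by
        calc 2 * r / E = 1 / (16 * k) * (1 / N) := by rw [hEe]; field_simp; norm_num
          _ ≤ 1 / (16 * k) * 1 := by
            gcongr
            rw [div_le_one (by linarith)]; exact hN1
          _ ≤ 1 / (8 * k) := by
            rw [mul_one]
            exact one_div_le_one_div_of_le (by linarith) (by linarith)
      have a4 : 1 / (8 * (k : ℝ)) = 1 / k / 8 := by field_simp
      have a5 : 1 / (4 * (k : ℝ)) = 1 / k / 4 := by field_simp
      have a6 : (0 : ℝ) < 1 / k := by positivity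
      linarith
    have hnot := prob_not fun x : Cube n => evalDNF D x ≠ h x
    simp only [ne_eq, not_not] at hnot
    unfold IsClose
    change 1 - ε ≤ prob fun x => evalDNF D x = h x
    rw [hnot]
    have : prob (fun x => ¬ evalDNF D x = h x) ≤ 1 / k := hkε
    linarith
  · intro i hi
    rw [Finset.mem_filter, not_and] at hi
    by_contra hlt
    exact hi (Finset.mem_univ i) (hω.agree_gt i (not_le.1 hlt))
  · calc (V.card : ℝ) * (1 / E + 2 * (D.card * (1 / 2) ^ w'))
        ≤ r * (1 / E + 2 * (1 / (4 * E))) := by gcongr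
      _ ≤ 2 * r / E := by
        rw [show r * (1 / E + 2 * (1 / (4 * E))) = 3 / 2 * r / E by field_simp; norm_num]
        gcongr; norm_num
  · intro T hT
    obtain ⟨t, ht, rfl⟩ := Finset.mem_image.1 hT
    obtain ⟨-, hb⟩ := Finset.mem_filter.1 ht
    by_contra hlt
    have := hω.bad_gt (P.listing n R t) (not_le.1 hlt)
    rw [hbad] at hb
    exact absurd hb (not_le.2 this)
  · intro T hTR hTw hTp
    obtain ⟨t, ht, hT⟩ := exists_listing_eq hR hcount T
      (fun i hi => (Finset.mem_filter.1 (hTR hi)).2) hTw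
    refine Finset.mem_image.2 ⟨t, Finset.mem_filter.2 ⟨Finset.mem_range.2 ht, ?_⟩, hT⟩
    rw [hbad]
    refine hω.bad_le (P.listing n R t) ?_
    subst hT
    exact hTp

end Accuracy

/-! ## The running time -/

section Time
variable {n s k : ℕ}

theorem termCount_bounds (hs : 1 ≤ s) (hk : 1 ≤ k) :
    4 * (s * k) ≤ termCount s k ∧ termWidth s k + 1 ≤ termCount s k ∧
      termBase s k - 1 ≤ termCount s k := by
  have hw := two_le_termWidth hs hk
  have hB := (le_base_sub_one hs hk).1
  have h1 : 2 ^ termWidth s k ≤ termCount s k := Nat.pow_le_pow_left (by omega) _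
  have h2 : 4 * (s * k) ≤ 2 ^ termWidth s k := Nat.le_pow_clog (by norm_num) _
  have h3 : termWidth s k < 2 ^ termWidth s k := Nat.lt_two_pow_self
  have h4 : termBase s k ≤ termCount s k := Nat.le_self_pow (by omega) _
  omega

theorem samples_le (hn : 1 ≤ n) (hs : 1 ≤ s) (hk : 1 ≤ k) :
    (params n s k).samples ≤ 2 ^ 16 * (termCount s k ^ 7 * Nat.clog 2 (n + 1)) := by
  obtain ⟨h1, h2, h3⟩ := termCount_bounds hs hk
  have hlg : 1 ≤ Nat.clog 2 (n + 1) := Nat.clog_pos (by norm_num) (by omega)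
  have hN := one_le_termCount s k
  have hk' : k ≤ s * k := Nat.le_mul_of_pos_left _ hs
  simp only [params, deviation, resolution]
  set N := termCount s k
  set g := Nat.clog 2 (n + 1)
  have h4 : 32 * (k * (N * (termBase s k - 1))) ≤ 32 * (N * (N * N)) := by
    gcongr; omega
  have h5 : g * (termWidth s k + 1) + 1 ≤ 2 * (N * g) := by
    have h6 : g * (termWidth s k + 1) ≤ g * N := Nat.mul_le_mul_left _ h2
    have h7 : 1 ≤ g * N := Nat.mul_pos hlg hN
    rw [mul_comm N]; omega
  calc _ ≤ 8 * (32 * (N * (N * N))) * (4 * (32 * (N * (N * N))) * (2 * (N * g))) := by gcongr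
    _ = 2 ^ 16 * (N ^ 7 * g) := by ring

theorem maxValue_size_le (hn : 1 ≤ n) (hs : 1 ≤ s) (hk : 1 ≤ k) :
    (maxValue n s k).size ≤ 30 * (termCount s k * Nat.clog 2 (n + 1)) := by
  have hlg : 1 ≤ Nat.clog 2 (n + 1) := Nat.clog_pos (by norm_num) (by omega)
  have hN := one_le_termCount s k
  have h1 := Nat.size_le_size (samples_le hn hs hk)
  have hself : ∀ a : ℕ, a.size ≤ a := fun a => Nat.size_le.2 Nat.lt_two_pow_self
  have hpow : ∀ a b : ℕ, (a ^ b).size ≤ 1 + b * a.size := by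
    intro a b
    induction b with
    | zero => simp
    | succ b ih =>
      rw [pow_succ, Nat.succ_mul]
      exact (size_mul_le _ _).trans (by omega)
  have h2 : (2 * (n + 1)).size ≤ Nat.clog 2 (n + 1) + 2 := by
    rw [Nat.size_le]
    have := Nat.le_pow_clog (b := 2) (by norm_num) (n + 1)
    rw [pow_add]
    omega
  have h3 := size_add_le (params n s k).samples (2 * (n + 1))
  have h4 := size_mul_le (2 ^ 16) (termCount s k ^ 7 * Nat.clog 2 (n + 1))
  have h5 := size_mul_le (termCount s k ^ 7) (Nat.clog 2 (n + 1))
  have h6 := hpow (termCount s k) 7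
  have h7 := hself (termCount s k)
  have h8 := hself (Nat.clog 2 (n + 1))
  rw [Nat.size_pow] at h4
  unfold maxValue
  set N := termCount s k
  set g := Nat.clog 2 (n + 1)
  have h9 : N * 1 ≤ N * g := Nat.mul_le_mul_left _ hlg
  have h10 : 1 * g ≤ N * g := Nat.mul_le_mul_right _ hN
  omega

theorem learnerTime_le (hn : 1 ≤ n) (hs : 1 ≤ s) (hk : 1 ≤ k) :
    learnerTime n s k ≤ 40000 * ((params n s k).samples * (n * termCount s k ^ 2)) := by
  obtain ⟨h1, h2, h3⟩ := termCount_bounds hs hk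
  have hN := one_le_termCount s k
  have hm : 1 ≤ (params n s k).samples := hN.trans (params_le hs hk).2.2.2.1
  unfold learnerTime
  set N := termCount s k
  set m := (params n s k).samples
  have hx : 1 ≤ n * N ^ 2 := Nat.mul_pos hn (by positivity)
  have e1 : N ≤ n * N ^ 2 := by nlinarith
  have e2 : n ≤ n * N ^ 2 := Nat.le_mul_of_pos_right _ (by positivity)
  have e3 : N * N ≤ n * N ^ 2 := by rw [← sq]; exact Nat.le_mul_of_pos_left _ hn
  have e4 : (N + 1) * (termWidth s k + 1) ≤ (N + N) * N := by gcongr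
  have e5 : (N + N) * N = 2 * (N * N) := by ring
  set x := n * N ^ 2
  have f1 : (m + 1) * ((n + 1) * 80) ≤ (m + m) * (160 * x) :=
    Nat.mul_le_mul (by omega) (by omega)
  have f2 : (m + 1) * ((n + 1) * 40 + (N + 1) * ((termWidth s k + 1) * 300)) ≤
      (m + m) * (680 * x) := by
    rw [← mul_assoc (N + 1)]
    exact Nat.mul_le_mul (by omega) (by omega)
  have f3 : 1 * x ≤ m * x := Nat.mul_le_mul_right _ hm
  have f4 : (m + m) * (160 * x) = 320 * (m * x) := by ring
  have f5 : (m + m) * (680 * x) = 1360 * (m * x) := by ring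
  omega

theorem total_time_le (hn : 1 ≤ n) (hs : 1 ≤ s) (hk : 1 ≤ k) :
    learnerTime n s k * (maxValue n s k).size ^ 2 ≤
      40000 * 2 ^ 16 * 30 ^ 2 * (n * Nat.clog 2 (n + 1) ^ 3 * termCount s k ^ 11) := by
  refine (Nat.mul_le_mul (learnerTime_le hn hs hk)
    (Nat.pow_le_pow_left (maxValue_size_le hn hs hk) 2)).trans ?_
  have h := samples_le hn hs hk
  set N := termCount s k
  set g := Nat.clog 2 (n + 1)
  calc _ ≤ 40000 * (2 ^ 16 * (N ^ 7 * g) * (n * N ^ 2)) * (30 * (N * g)) ^ 2 := by gcongr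
    _ = _ := by ring

theorem evalTime_le (hs : 1 ≤ s) (hk : 1 ≤ k) :
    (termCount s k + 1) * ((termWidth s k + 1) * 320) ≤ learnerTime n s k := by
  have hm : 1 ≤ (params n s k).samples :=
    (one_le_termCount s k).trans (params_le hs hk).2.2.2.1
  have h : (1 + 1) * ((n + 1) * 40 + (termCount s k + 1) * ((termWidth s k + 1) * 300)) ≤
      ((params n s k).samples + 1) *
        ((n + 1) * 40 + (termCount s k + 1) * ((termWidth s k + 1) * 300)) := by gcongr
  unfold learnerTime
  have e1 : (termCount s k + 1) * ((termWidth s k + 1) * 320) =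
      320 * ((termCount s k + 1) * (termWidth s k + 1)) := by ring
  have e2 : (termCount s k + 1) * ((termWidth s k + 1) * 300) =
      300 * ((termCount s k + 1) * (termWidth s k + 1)) := by ring
  omega

section Growth
variable {ε : ℝ}

theorem termWidth_le (hs : 1 ≤ s) (hε : 0 < ε) (hε1 : ε ≤ 1) :
    (termWidth s ⌈1 / ε⌉₊ : ℝ) ≤ Real.logb 2 (s / ε) + 4 := by
  have h1ε : 1 ≤ 1 / ε := one_le_one_div hε hε1
  have hk : 1 ≤ ⌈1 / ε⌉₊ := Nat.one_le_iff_ne_zero.2 (Nat.ceil_pos.2 (by linarith)).ne'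
  have hk2 : (⌈1 / ε⌉₊ : ℝ) ≤ 2 * (1 / ε) := by
    have := Nat.ceil_lt_add_one (a := 1 / ε) (by linarith)
    linarith
  have hs0 : (0 : ℝ) < s := by exact_mod_cast hs
  have hw := two_le_termWidth hs hk
  have h1 : 2 ^ (termWidth s ⌈1 / ε⌉₊ - 1) < 4 * (s * ⌈1 / ε⌉₊) :=
    Nat.pow_pred_clog_lt_self (by norm_num) (by have := Nat.mul_le_mul hs hk; omega)
  have h2 : (2 : ℝ) ^ (termWidth s ⌈1 / ε⌉₊ - 1) < 8 * (s / ε) := by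
    calc (2 : ℝ) ^ (termWidth s ⌈1 / ε⌉₊ - 1) < 4 * (s * ⌈1 / ε⌉₊) := by exact_mod_cast h1
      _ ≤ 4 * (s * (2 * (1 / ε))) := by gcongr
      _ = 8 * (s / ε) := by ring
  have h3 := Real.logb_lt_logb (b := 2) (by norm_num) (by positivity) h2
  rw [Real.logb_mul (by norm_num) (by positivity), Real.logb_pow, Real.logb_self_eq_one
    (by norm_num), Nat.cast_sub (by omega), show (8 : ℝ) = 2 ^ 3 by norm_num, Real.logb_pow,
    Real.logb_self_eq_one (by norm_num)] at h3
  push_cast at h3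
  linarith

theorem clog_le_logb {x : ℕ} (hx : 1 < x) : (Nat.clog 2 x : ℝ) ≤ Real.logb 2 x + 1 := by
  have h1 : (2 : ℝ) ^ (Nat.clog 2 x - 1) < x := by
    exact_mod_cast Nat.pow_pred_clog_lt_self (by norm_num) hx
  have h2 := Real.logb_lt_logb (b := 2) (by norm_num) (by positivity) h1
  rw [Real.logb_pow, Real.logb_self_eq_one (by norm_num),
    Nat.cast_sub (Nat.clog_pos (by norm_num) hx)] at h2
  push_cast at h2
  linarith

theorem termCount_pow_le (hs : 1 ≤ s) (hε : 0 < ε) (hε1 : ε ≤ 1)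
    (hL : 1 ≤ Real.logb 2 (s / ε)) (hq : 2 ≤ s * Real.logb 2 (s / ε)) :
    (termCount s ⌈1 / ε⌉₊ : ℝ) ^ 11 ≤
      (s * Real.logb 2 (s / ε)) ^ (605 * Real.logb 2 (s / ε)) := by
  have hw := termWidth_le hs hε hε1
  set L := Real.logb 2 (s / ε)
  set w := termWidth s ⌈1 / ε⌉₊ with hwdef
  set q := s * L with hqdef
  have hs0 : (0 : ℝ) < s := by exact_mod_cast hs
  have hw5 : (w : ℝ) ≤ 5 * L := by linarith
  have hB : (termBase s ⌈1 / ε⌉₊ : ℝ) ≤ q ^ 11 := by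
    have h1 : (s * w : ℝ) ≤ 5 * q := by
      calc (s * w : ℝ) ≤ s * (5 * L) := by gcongr
        _ = 5 * q := by rw [hqdef]; ring
    have h2 : (termBase s ⌈1 / ε⌉₊ : ℝ) = 16 * (s * w) ^ 2 + 1 := by
      simp only [termBase, ← hwdef]; push_cast; ring
    have h3 : (s * w : ℝ) ^ 2 ≤ (5 * q) ^ 2 := by gcongr
    have h4 : (2 : ℝ) ^ 9 ≤ q ^ 9 := by gcongr
    have h5 : 4 ≤ q ^ 2 := by nlinarith
    calc (termBase s ⌈1 / ε⌉₊ : ℝ) ≤ 2 ^ 9 * q ^ 2 := by rw [h2]; nlinarith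
      _ ≤ q ^ 9 * q ^ 2 := by gcongr
      _ = q ^ 11 := by ring
  have hq0 : 0 < q := by linarith
  calc (termCount s ⌈1 / ε⌉₊ : ℝ) ^ 11 = ((termBase s ⌈1 / ε⌉₊ : ℝ) ^ w) ^ 11 := by
        simp only [termCount, ← hwdef]; push_cast; rfl
    _ ≤ ((q ^ 11) ^ w) ^ 11 := by gcongr
    _ = q ^ ((121 * w : ℕ) : ℝ) := by
        rw [Real.rpow_natCast, ← pow_mul, ← pow_mul]; congr 1; ring
    _ ≤ q ^ (605 * L) := by
        refine Real.rpow_le_rpow_of_exponent_le (by linarith) ?_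
        push_cast; linarith

theorem exp_neg_le_rpow_self {a x : ℝ} (ha : 0 ≤ a) (hx : 0 ≤ x) :
    Real.exp (-a) ≤ x ^ (a * x) := by
  rcases hx.eq_or_lt with rfl | hx
  · simpa using ha
  · rw [Real.rpow_def_of_pos hx, Real.exp_le_exp]
    have h1 := Real.one_sub_inv_le_log_of_pos hx
    have h2 : x - 1 ≤ x * Real.log x := by
      have := mul_le_mul_of_nonneg_left h1 hx.le
      rwa [mul_sub, mul_one, mul_inv_cancel₀ hx.ne'] at this
    nlinarith

theorem termCount_one_le {k : ℕ} (hk : k ≤ 4) : termCount 1 k ≤ 257 ^ 4 := by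
  have hw : termWidth 1 k ≤ 4 := Nat.clog_le_of_le_pow (by omega)
  have hB : termBase 1 k ≤ 257 := by
    unfold termBase
    have := Nat.mul_le_mul hw hw
    simp only [one_mul]
    omega
  exact (Nat.pow_le_pow_left hB _).trans (Nat.pow_le_pow_right (by norm_num) hw)

theorem growth_le (hn : 1 ≤ n) (hs : 1 ≤ s) (hε : 0 < ε) (hε1 : ε ≤ 1) :
    (n * Nat.clog 2 (n + 1) ^ 3 * termCount s ⌈1 / ε⌉₊ ^ 11 : ℝ) ≤
      (Real.exp 605 * 1212 ^ 3 * (257 ^ 4) ^ 11) * mainTerm 605 n s ε *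
        Real.logb 2 (2 + mainTerm 605 n s ε) ^ 3 := by
  have hs1 : (1 : ℝ) ≤ s := by exact_mod_cast hs
  have hn1 : (1 : ℝ) ≤ n := by exact_mod_cast hn
  have hL0 : 0 ≤ Real.logb 2 (s / ε) :=
    Real.logb_nonneg (by norm_num) ((one_le_div hε).2 (hε1.trans hs1))
  have h605 : (1 : ℝ) ≤ Real.exp 605 := Real.one_le_exp (by norm_num)
  obtain ⟨Z, hZ⟩ : ∃ Z, Z = (s * Real.logb 2 (s / ε)) ^ (605 * Real.logb 2 (s / ε)) := ⟨_, rfl⟩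
  have hY : mainTerm 605 n s ε = n * Z := by rw [hZ, mainTerm]
  suffices h : Real.exp (-605) ≤ Z ∧
      (termCount s ⌈1 / ε⌉₊ : ℝ) ^ 11 ≤ Real.exp 605 * (257 ^ 4) ^ 11 * Z by
    obtain ⟨hZ1, hN⟩ := h
    have hZ0 : 0 < Z := (Real.exp_pos _).trans_le hZ1
    rw [hY]
    obtain ⟨Y, hYn⟩ : ∃ Y, Y = n * Z := ⟨_, rfl⟩
    rw [← hYn]
    have hY0 : 0 < Y := by rw [hYn]; positivity
    have hnY : (n : ℝ) ≤ Real.exp 605 * Y := by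
      have h1 : 1 ≤ Real.exp 605 * Z := by
        have := mul_le_mul_of_nonneg_left hZ1 (Real.exp_pos 605).le
        rwa [← Real.exp_add, add_neg_cancel, Real.exp_zero] at this
      rw [hYn]; nlinarith
    set M := Real.logb 2 (2 + Y)
    have hM1 : 1 ≤ M := by
      rw [← Real.logb_self_eq_one (b := 2) (by norm_num)]
      exact Real.logb_le_logb_of_le (by norm_num) (by norm_num) (by linarith)
    have hlg : (Nat.clog 2 (n + 1) : ℝ) ≤ 1212 * M := by
      have h1 := clog_le_logb (x := n + 1) (by omega)
      have h2 : Real.logb 2 ((n + 1 : ℕ) : ℝ) ≤ Real.logb 2 (Real.exp 605 * (2 + Y)) := by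
        refine Real.logb_le_logb_of_le (by norm_num) (by positivity) ?_
        push_cast; linarith
      have h3 : Real.logb 2 (Real.exp 605) ≤ 1210 := by
        rw [Real.logb, Real.log_exp, div_le_iff₀ (Real.log_pos (by norm_num))]
        linarith [Real.log_two_gt_d9]
      rw [Real.logb_mul (Real.exp_pos _).ne' (by linarith)] at h2
      linarith
    calc (n * Nat.clog 2 (n + 1) ^ 3 * termCount s ⌈1 / ε⌉₊ ^ 11 : ℝ)
        ≤ n * (1212 * M) ^ 3 * (Real.exp 605 * (257 ^ 4) ^ 11 * Z) := by gcongr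
      _ = (Real.exp 605 * 1212 ^ 3 * (257 ^ 4) ^ 11) * Y * M ^ 3 := by rw [hYn]; ring
  by_cases hc : 2 ≤ s ∨ 2 ≤ Real.logb 2 (s / ε)
  · have hL1 : 1 ≤ Real.logb 2 (s / ε) := by
      rcases hc with hc | hc
      · rw [← Real.logb_self_eq_one (b := 2) (by norm_num)]
        refine Real.logb_le_logb_of_le (by norm_num) (by norm_num) ?_
        have : (2 : ℝ) ≤ s := by exact_mod_cast hc
        rw [le_div_iff₀ hε]; nlinarith
      · linarith
    have hq : 2 ≤ s * Real.logb 2 (s / ε) := by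
      rcases hc with hc | hc
      · have : (2 : ℝ) ≤ s := by exact_mod_cast hc
        nlinarith
      · nlinarith
    have hZ1 : 1 ≤ Z := hZ ▸ Real.one_le_rpow (by linarith) (by linarith)
    refine ⟨(Real.exp_le_one_iff.2 (by norm_num)).trans hZ1,
      (hZ ▸ termCount_pow_le hs hε hε1 hL1 hq).trans (le_mul_of_one_le_left (by linarith) ?_)⟩
    exact one_le_mul_of_one_le_of_one_le h605 (by norm_num)
  · push Not at hc
    obtain ⟨hs2, hL2⟩ := hc
    obtain rfl : s = 1 := by omega
    have hZ1 : Real.exp (-605) ≤ Z := by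
      rw [hZ, Nat.cast_one, one_mul]
      exact exp_neg_le_rpow_self (by norm_num) (by simpa using hL0)
    refine ⟨hZ1, ?_⟩
    have hk : ⌈1 / ε⌉₊ ≤ 4 := by
      refine Nat.ceil_le.2 ?_
      rw [Real.logb_lt_iff_lt_rpow (by norm_num) (by positivity)] at hL2
      norm_num at hL2 ⊢
      exact hL2.le
    have h1 : (termCount 1 ⌈1 / ε⌉₊ : ℝ) ≤ 257 ^ 4 := by exact_mod_cast termCount_one_le hk
    have h2 : 1 ≤ Real.exp 605 * Z := by
      have := mul_le_mul_of_nonneg_left hZ1 (Real.exp_pos 605).le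
      rwa [← Real.exp_add, add_neg_cancel, Real.exp_zero] at this
    calc (termCount 1 ⌈1 / ε⌉₊ : ℝ) ^ 11 ≤ (257 ^ 4) ^ 11 := by gcongr
      _ ≤ (257 ^ 4) ^ 11 * (Real.exp 605 * Z) := le_mul_of_one_le_right (by positivity) h2
      _ = _ := by ring

end Growth

end Time

theorem evalHypothesis_oracleFree : evalHypothesis.OracleFree := by
  simp [evalHypothesis, runConjunction, Program.count, Program.OracleFree]

theorem learner_outputs {n s k : ℕ} (hn : 1 ≤ n) (hs : 1 ≤ s) (hk : 1 ≤ k) (f : Cube n → Bool)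
    (ω : Source n) {T : ℝ}
    (hT : (learnerTime n s k * (maxValue n s k).size ^ 2 : ℕ) ≤ T) :
    ∃ (h : Cube n → Bool) (R : ℕ → ℕ), Outputs learner evalHypothesis s k f ω T h ∧
      Selects n (termBase s k) (fun i => (params n s k).agreeThreshold <
        agreeCount ⟨f, ω.1, ω.2⟩ (params n s k).samples i) R ∧
      ∀ x, h x = true ↔ ∃ t < termCount s k,
        badCount ⟨f, ω.1, ω.2⟩ (params n s k) R (params n s k).samples (params n s k).samples t ≤
          (params n s k).badThreshold ∧ (params n s k).Sat R t x := by
  obtain ⟨t, σ, hexec, ht, hσ, hR, hbad⟩ :=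
    learner_halts (O := ⟨f, ω.1, ω.2⟩) hn hs hk (le_refl (maxValue n s k).size)
  have hl : 1 ≤ (maxValue n s k).size := Nat.size_pos.2 (by unfold maxValue; omega)
  refine ⟨fun x => decide (∃ t < termCount s k,
    badCount ⟨f, ω.1, ω.2⟩ (params n s k) (σ.arr 2) (params n s k).samples
      (params n s k).samples t ≤ (params n s k).badThreshold ∧
      (params n s k).Sat (σ.arr 2) t x), σ.arr 2, ⟨σ, t, hexec, ?_, fun x => ?_⟩, hR,
    fun x => decide_eq_true_iff⟩
  · exact le_trans (by exact_mod_cast ht) hT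
  · obtain ⟨u, τ, hu, hu', hτ⟩ :=
      evalHypothesis_halts (O := noOracles n) hl hσ hR.range x
    refine ⟨τ, u, hu, le_trans ?_ hT, ?_⟩
    · exact_mod_cast hu'.trans (Nat.mul_le_mul_right _ (evalTime_le hs hk))
    · rw [hτ, decide_eq_true_iff]
      refine exists_congr fun t => and_congr_right fun ht => ?_
      rw [hbad t ht]

theorem IsMonotoneDNF.monotone {n s : ℕ} {f : Cube n → Bool} (hf : IsMonotoneDNF s f)
    (x y : Cube n) (hxy : ∀ i, x i = true → y i = true) (hx : f x = true) : f y = true := by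
  obtain ⟨D, -, hD⟩ := hf
  obtain ⟨T, hT, h⟩ := (hD x).1 hx
  exact (hD y).2 ⟨T, hT, fun i hi => hxy i (h i hi)⟩

end MonotoneDNF

theorem mainTheorem5 :
    ∃ (L V : MonotoneDNF.Program) (a A : ℝ) (b : ℕ), 0 < a ∧ 0 < A ∧
      MonotoneDNF.PACLearns L V (fun _ s => {f | MonotoneDNF.IsMonotoneDNF s f})
        (fun n s ε => A * MonotoneDNF.mainTerm a n s ε *
          Real.logb 2 (2 + MonotoneDNF.mainTerm a n s ε) ^ b) := by
  open MonotoneDNF in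
  refine ⟨learner, evalHypothesis, 605,
    (40000 * 2 ^ 16 * 30 ^ 2) * (Real.exp 605 * 1212 ^ 3 * (257 ^ 4) ^ 11), 3, by norm_num,
    by positivity, evalHypothesis_oracleFree, fun n s ε hn hs hε hε1 f hf => ?_⟩
  have hk : 1 ≤ ⌈1 / ε⌉₊ := Nat.one_le_iff_ne_zero.2 (Nat.ceil_pos.2 (by positivity)).ne'
  have hT : ((learnerTime n s ⌈1 / ε⌉₊ * (maxValue n s ⌈1 / ε⌉₊).size ^ 2 : ℕ) : ℝ) ≤
      (40000 * 2 ^ 16 * 30 ^ 2) * (Real.exp 605 * 1212 ^ 3 * (257 ^ 4) ^ 11) *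
        mainTerm 605 n s ε * Real.logb 2 (2 + mainTerm 605 n s ε) ^ 3 := by
    have h1 : ((learnerTime n s ⌈1 / ε⌉₊ * (maxValue n s ⌈1 / ε⌉₊).size ^ 2 : ℕ) : ℝ) ≤
        (40000 * 2 ^ 16 * 30 ^ 2) *
          (n * Nat.clog 2 (n + 1) ^ 3 * termCount s ⌈1 / ε⌉₊ ^ 11) := by
      exact_mod_cast total_time_le hn hs hk
    have h2 := mul_le_mul_of_nonneg_left (growth_le hn hs hε hε1)
      (show (0 : ℝ) ≤ 40000 * 2 ^ 16 * 30 ^ 2 by norm_num)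
    refine h1.trans (h2.trans (le_of_eq ?_))
    ring
  constructor
  · intro ω
    obtain ⟨h, -, hh, -⟩ := learner_outputs hn hs hk f ω hT
    exact ⟨h, hh⟩
  · refine (half_le_typical (n := n) hs hk (f := f) (IsMonotoneDNF.monotone hf)).trans
      (measure_mono fun ω hω => ?_)
    obtain ⟨h, R, hh, hR, hh'⟩ := learner_outputs hn hs hk f ω hT
    refine ⟨h, hh, isClose_of_typical hs hk ?_ hf hω hR hh'⟩
    rw [one_div_le (by exact_mod_cast hk) hε]
    exact Nat.le_ceil _
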